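/- **Setting.** Let $k_0\in\mathbb N$, $a>0$, $b_k<0$ and $\eta^k_{i,j}\in\mathbb R$ for $2\le i,j,k\le k_0$. For $\rho>0$ and $\varepsilon_1(0)>0$ put $\varepsilon=\rho^3\varepsilon_1(0)$ and $A=a\,\varepsilon^{1/6}$. With $F_1=2^{-1/2}\varepsilon_1$, consider the system $$\begin{aligned} u_{1,1}'&=F_1u_{1,1}-1+2^{-1/2}u_{1,1}^2+2^{-1/2}\sum_{j=2}^{k_0}u_{j,1}^2+H^u_{1,1},\qquad r_1'=-r_1F_1,\\ u_{k,1}'&=F_1u_{k,1}+\tfrac{b_k}{4A^2}\varepsilon_1^{1/3}u_{k,1}-v_{k,1}+2^{1/2}u_{1,1}u_{k,1}+\sum_{i,j=2}^{k_0}\eta^k_{i,j}u_{i,1}u_{j,1}+H^u_{k,1},\\ v_{k,1}'&=2F_1v_{k,1}+\tfrac{b_k}{4A^2}r_1^3\varepsilon_1^{4/3}v_{k,1}+\varepsilon_1H^v_{k,1},\qquad \varepsilon_1'=3F_1\varepsilon_1 \end{aligned}$$ for $2\le k\le k_0$. Here $H^u_{1,1},H^u_{k,1},H^v_{k,1}$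 are functions of $(u_{1,1},r_1,(u_{j,1}),(v_{j,1}),\varepsilon_1)$ that, on $\{r_1>0,\varepsilon_1>0\}$ near $p_a=(-2^{1/4},0,0,0,0)$, are locally Lipschitz and satisfy $$\begin{aligned} H^u_{1,1}&=\mathcal O(r_1\varepsilon_1,\,r_1^2,\,r_1^2v_{j,1}^2,\,r_1u_{1,1},\,r_1u_{j,1}v_{j,1},\,r_1u_{1,1}u_{j,1}^2,\,r_1u_{j,1}u_{i,1}u_{l,1}),\\ H^u_{k,1}&=\mathcal O(r_1^2v_{k,1},\,r_1^2v_{i,1}v_{j,1},\,r_1u_{1,1}v_{k,1},\,r_1u_{k,1},\,r_1u_{i,1}v_{j,1},\,r_1u_{1,1}^2u_{k,1},\,r_1u_{1,1}u_{i,1}u_{j,1},\,r_1u_{j,1}u_{i,1}u_{l,1}),\\ H^v_{k,1}&=\mathcal O(r_1^4v_{k,1},\,r_1^4v_{i,1}v_{j,1}),\qquad 2\le i,j,l\le k_0, \end{aligned}$$ where $H=\mathcal O(m_1,m_2,\dots)$ means that $|H|$ is bounded near $p_a$ by a constant times the sum of all the $|m_n|$, over all values of the indices $i,j,l$. **Lemma.**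 There are $c_0,\rho_0,\delta_0>0$ such that for every $\rho\in(0,\rho_0]$ there is $\kappa_0>0$ such that for all $\delta\in(0,\delta_0]$ and $\kappa\in(0,\kappa_0]$ there are $\sigma_u,\sigma_v\in[\kappa,1)$ with the following property. Let $\varepsilon_1(0)\in(0,\delta]$, let $T_1=\frac{\sqrt2}{3}\big(\frac1{\varepsilon_1(0)}-\frac1\delta\big)$, and let initial data be given with $$|u_{1,1}(0)+2^{1/4}|\le c_0,\quad r_1(0)=\rho,\quad u_{k,1}(0)=\tfrac{u_k(0)}{\rho},\quad v_{k,1}(0)=\tfrac{v_k(0)}{\rho^2},$$ $$|u_k(0)|\le C_{k,u_0},\quad |v_k(0)|\le C_{k,v_0}\varepsilon^{4/3},\quad \sum_{k=2}^{k_0}C_{k,u_0}^2\le\kappa,\quad\sum_{k=2}^{k_0}C_{k,v_0}^2\le\kappa .$$ Then a solution with these data exists on $[0,T_1]$, and every solution with these data on an interval $[0,\tau]$ with $0\le\tau\le T_1$ satisfies, for all $t\in[0,\tau]$ and $2\le k\le k_0$, $$|u_{k,1}(t)|\le\frac1\rho|u_k(0)|+\frac{8a^2\rho}{|b_k|}\Big[\sigma_u+\sigma_v\,\varepsilon_1(0)^{2/3}\rho^2\delta^{2/3}\Big(1+\frac{8a^2}{|b_k|}\Big)\Big]$$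 and $$|v_{k,1}(t)|\le\frac{\delta^{2/3}}{\varepsilon_1(0)^{2/3}\rho^2}|v_k(0)|+\varepsilon_1(0)^{2/3}\delta^{2/3}\frac{8a^2\rho^2}{|b_k|}\sigma_v\le\varepsilon_1(0)^{2/3}\rho^2\delta^{2/3}\Big(C_{k,v_0}+\frac{8a^2}{|b_k|}\sigma_v\Big).$$ -/

import Mathlib

open Filter Topology Set Asymptotics

/-- The indices `k` with `2 ≤ k ≤ k₀`. -/
abbrev Mode (k₀ : ℕ) : Type := {k : ℕ // k ∈ Finset.Icc 2 k₀}

/-- Points `(u₁₁, r₁, (u_{k,1})_k, (v_{k,1})_k, ε₁)` of the chart `K₁`. -/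
abbrev K1State (k₀ : ℕ) : Type := ℝ × ℝ × (Mode k₀ → ℝ) × (Mode k₀ → ℝ) × ℝ

noncomputable section

namespace K1State

variable {k₀ : ℕ}

/-- The coordinate `u_{1,1}`. -/
def u₁ (x : K1State k₀) : ℝ := x.1

/-- The coordinate `r_1`. -/
def r (x : K1State k₀) : ℝ := x.2.1

/-- The coordinates `u_{k,1}`, `2 ≤ k ≤ k₀`. -/
def u (x : K1State k₀) : Mode k₀ → ℝ := x.2.2.1

/-- The coordinates `v_{k,1}`, `2 ≤ k ≤ k₀`. -/
def v (x : K1State k₀) : Mode k₀ → ℝ := x.2.2.2.1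

/-- The coordinate `ε_1`. -/
def e (x : K1State k₀) : ℝ := x.2.2.2.2

end K1State

/-- The attracting steady state `p_a = (-2^{1/4}, 0, 0, 0, 0)`. -/
def k1SteadyState (k₀ : ℕ) : K1State k₀ := (-(2 : ℝ) ^ (1 / 4 : ℝ), 0, 0, 0, 0)

/-- Neighbourhoods of `p_a` inside `{r₁ > 0, ε₁ > 0}`. -/
def k1Near (k₀ : ℕ) : Filter (K1State k₀) :=
  𝓝[{x : K1State k₀ | 0 < x.r ∧ 0 < x.e}] k1SteadyState k₀

/-- The sum of the absolute values of the monomials in the order symbol for `H^u_{1,1}`. -/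
def orderU₁ {k₀ : ℕ} (x : K1State k₀) : ℝ :=
  |x.r * x.e| + |x.r ^ 2| + (∑ j, |x.r ^ 2 * x.v j ^ 2|) + |x.r * x.u₁|
    + (∑ j, |x.r * x.u j * x.v j|) + (∑ j, |x.r * x.u₁ * x.u j ^ 2|)
    + ∑ i, ∑ j, ∑ l, |x.r * x.u j * x.u i * x.u l|

/-- The sum of the absolute values of the monomials in the order symbol for `H^u_{k,1}`. -/
def orderU {k₀ : ℕ} (k : Mode k₀) (x : K1State k₀) : ℝ :=
  |x.r ^ 2 * x.v k| + (∑ i, ∑ j, |x.r ^ 2 * x.v i * x.v j|) + |x.r * x.u₁ * x.v k|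
    + |x.r * x.u k| + (∑ i, ∑ j, |x.r * x.u i * x.v j|) + |x.r * x.u₁ ^ 2 * x.u k|
    + (∑ i, ∑ j, |x.r * x.u₁ * x.u i * x.u j|)
    + ∑ i, ∑ j, ∑ l, |x.r * x.u j * x.u i * x.u l|

/-- The sum of the absolute values of the monomials in the order symbol for `H^v_{k,1}`. -/
def orderV {k₀ : ℕ} (k : Mode k₀) (x : K1State k₀) : ℝ :=
  |x.r ^ 4 * x.v k| + ∑ i, ∑ j, |x.r ^ 4 * x.v i * x.v j|

/-- `F_1(ε_1) = 2^{-1/2} ε_1`. -/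
def k1F (e : ℝ) : ℝ := (2 : ℝ) ^ (-1 / 2 : ℝ) * e

/-- The right-hand side of the system in the chart `K₁`, with eigenvalue numerators `b`, rescaled
domain half-length `A`, quadratic coefficients `η k i j` and higher-order terms `H₁`, `Hu`, `Hv`. -/
def k1Field {k₀ : ℕ} (A : ℝ) (b : Mode k₀ → ℝ) (η : Mode k₀ → Mode k₀ → Mode k₀ → ℝ)
    (H₁ : K1State k₀ → ℝ) (Hu Hv : Mode k₀ → K1State k₀ → ℝ) (x : K1State k₀) : K1State k₀ :=
  ( k1F x.e * x.u₁ - 1 + (2 : ℝ) ^ (-1 / 2 : ℝ) * x.u₁ ^ 2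
      + (2 : ℝ) ^ (-1 / 2 : ℝ) * (∑ j, x.u j ^ 2) + H₁ x,
    -(x.r * k1F x.e),
    fun k => k1F x.e * x.u k + b k / (4 * A ^ 2) * x.e ^ (1 / 3 : ℝ) * x.u k - x.v k
      + (2 : ℝ) ^ (1 / 2 : ℝ) * x.u₁ * x.u k + (∑ i, ∑ j, η k i j * x.u i * x.u j) + Hu k x,
    fun k => 2 * k1F x.e * x.v k + b k / (4 * A ^ 2) * x.r ^ 3 * x.e ^ (4 / 3 : ℝ) * x.v k
      + x.e * Hv k x,
    3 * k1F x.e * x.e )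

/-- `x` solves `x' = k1Field … x` on `[0, τ]` (one-sided derivatives at the end points). -/
def IsK1Solution {k₀ : ℕ} (A : ℝ) (b : Mode k₀ → ℝ) (η : Mode k₀ → Mode k₀ → Mode k₀ → ℝ)
    (H₁ : K1State k₀ → ℝ) (Hu Hv : Mode k₀ → K1State k₀ → ℝ) (τ : ℝ) (x : ℝ → K1State k₀) : Prop :=
  ∀ t ∈ Icc 0 τ, HasDerivWithinAt x (k1Field A b η H₁ Hu Hv (x t)) (Icc 0 τ) t

/-- The transition time `T_1 = (√2 / 3) (1 / ε_1(0) - 1 / δ)`. -/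
def k1Time (δ e₀ : ℝ) : ℝ := Real.sqrt 2 / 3 * (1 / e₀ - 1 / δ)

/-- The point of `{r₁ = ρ}` with coordinates `u_{1,1} = w`, `ε_1 = e₀`, and with
`u_k = ρ u_{k,1}`, `v_k = ρ² v_{k,1}` in the original variables. -/
def k1Initial {k₀ : ℕ} (ρ e₀ w : ℝ) (u₀ v₀ : Mode k₀ → ℝ) : K1State k₀ :=
  (w, ρ, fun k => u₀ k / ρ, fun k => v₀ k / ρ ^ 2, e₀)

end

/-!
The subsystem for `r₁` and `ε₁` is closed and explicit: `1 / ε₁` decreases at the constant rate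
`3 / √2`, so that `ε₁` grows from `ε₁(0)` to at most `δ` on `[0, T₁]`, and `r₁³ ε₁ = ε` is a first
integral, so that `r₁` stays in `(0, ρ]`. By the choice `A = ε^{1/6} a`, the damping rate of `u_{k,1}`
equals `|b_k| / (4 a² r₁) ≥ |b_k| / (4 a² ρ)`, and that of `v_{k,1}` equals `|b_k| r₁² ε₁ / (4 a²)`
(`damping_u`, `damping_v`).

The other coordinates are controlled one at a time by a barrier argument
(`abs_le_of_mul_deriv_nonpos`), as long as the solution remains in a small box around `p_a`.
* `u_{1,1}` is attracted by `-2^{1/4}` (`abs_u₁_add_le`).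
* `u_{k,1}` is forced by terms of total size at most `1` and damped, which costs an offset
  `4 a² ρ / |b_k|` (`abs_u_le`).
* `W_k = r₁² v_{k,1}`, the original variable `v_k`, is damped without the growth term `2 F₁`. Its
  remainder is `r₁² ε₁ O(r₁² W_k, W_i W_j)`: the first part is absorbed by the damping for small `ρ`,
  and if `|W_i| ≤ c ε^{2/3}` with `c` small, the second costs an offset `4 a² ε^{4/3} / |b_k|`
  (`abs_r_sq_mul_v_le`). Dividing by `r₁² = ε^{2/3} ε₁^{-2/3}` gives the bound for `v_{k,1}`.

These offsets are half of `8 a² ρ / |b_k|` and `8 a² ε^{4/3} / |b_k|`, so the estimates hold with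
`σ_u = σ_v = 1/2`. The bounds obtained are strictly better than those defining the box and the
condition `|W_i| ≤ c ε^{2/3}`, once `ρ` is small and `κ` is small compared with `ρ²`. By continuous
induction the solution never leaves this region (`mem_k1Trap_of_solves`). For the existence on
`[0, T₁]` (`exists_isK1Solution`) the field is truncated to the compact box by a coordinatewise
projection; the truncated field is bounded and globally Lipschitz, and its solution is confined to
the region where the truncation has no effect.
-/

/-! ### Scalar barriers, continuous induction and truncated fields -/

/-- If `y²` does not grow as long as `|y| ≥ M`, the bound `|y| ≤ M` propagates. Each a priori estimate
below is an application of this to one coordinate. -/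
theorem abs_le_of_mul_deriv_nonpos {y y' : ℝ → ℝ} {s M : ℝ}
    (hy : ∀ t ∈ Icc 0 s, HasDerivWithinAt y (y' t) (Icc 0 s) t) (h0 : |y 0| ≤ M)
    (hM : ∀ t ∈ Icc 0 s, M ≤ |y t| → y t * y' t ≤ 0) :
    ∀ t ∈ Icc 0 s, |y t| ≤ M := by
  intro t₁ ht₁
  by_contra! hlt
  have hcont : ContinuousOn y (Icc 0 s) := fun t ht => (hy t ht).continuousWithinAt
  have hsub : Icc 0 t₁ ⊆ Icc 0 s := Icc_subset_Icc_right ht₁.2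
  -- the last time before `t₁` at which `|y| ≤ M`
  obtain ⟨t₀, ⟨ht₀, hyt₀⟩, hmax⟩ : ∃ t₀, IsGreatest (Icc 0 t₁ ∩ {t | |y t| ≤ M}) t₀ := by
    have hcl : IsClosed (Icc 0 t₁ ∩ {t | |y t| ≤ M}) :=
      ((hcont.mono hsub).abs).preimage_isClosed_of_isClosed isClosed_Icc isClosed_Iic
    exact (isCompact_Icc.of_isClosed_subset hcl inter_subset_left).exists_isGreatest
      ⟨0, ⟨le_rfl, ht₁.1⟩, h0⟩
  have hsub' : Icc t₀ t₁ ⊆ Icc 0 s := (Icc_subset_Icc_left ht₀.1).trans hsub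
  have hanti : AntitoneOn (fun t => y t ^ 2) (Icc t₀ t₁) := by
    refine antitoneOn_of_hasDerivWithinAt_nonpos (f' := fun t => 2 * (y t * y' t))
      (convex_Icc _ _) ((hcont.mono hsub').pow 2) (fun t ht => ?_) (fun t ht => ?_)
    · have := ((hy t (hsub' (interior_subset ht))).mono
        (interior_subset.trans hsub')).pow 2
      refine this.congr_deriv ?_
      simp; ring
    · rw [interior_Icc] at ht
      have h1 : M ≤ |y t| := by
        by_contra! h
        exact absurd (hmax ⟨⟨ht₀.1.trans ht.1.le, ht.2.le⟩, h.le⟩) (not_le.2 ht.1)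
      have := hM t (hsub' ⟨ht.1.le, ht.2.le⟩) h1
      linarith
  have h2 := hanti (left_mem_Icc.2 ht₀.2) (right_mem_Icc.2 ht₀.2) ht₀.2
  exact absurd ((sq_le_sq.1 h2).trans hyt₀) (not_le.2 hlt)

theorem eq_initial_of_hasDerivWithinAt_zero {f : ℝ → ℝ} {τ : ℝ}
    (hf : ∀ t ∈ Icc 0 τ, HasDerivWithinAt f 0 (Icc 0 τ) t) : ∀ t ∈ Icc 0 τ, f t = f 0 := by
  intro t ht
  exact constant_of_has_deriv_right_zero (fun t ht => (hf t ht).continuousWithinAt)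
    (fun t ht => (hf t (Ico_subset_Icc_self ht)).mono_of_mem_nhdsWithin
      (Icc_mem_nhdsGE_of_mem ht)) t ht

/-- Continuous induction: a curve starting in a closed set `C` stays there if, whenever it has been in
`C` up to time `s`, it is in the interior of `C` at time `s`. -/
theorem mem_of_forall_mem_imp_mem_nhds {X : Type*} [TopologicalSpace X] {x : ℝ → X} {C : Set X}
    {τ : ℝ} (hC : IsClosed C) (hx : ContinuousOn x (Icc 0 τ)) (h0 : x 0 ∈ C)
    (h : ∀ s ∈ Icc 0 τ, (∀ t ∈ Icc 0 s, x t ∈ C) → C ∈ 𝓝 (x s)) :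
    ∀ t ∈ Icc 0 τ, x t ∈ C := by
  refine IsClosed.Icc_subset_of_forall_mem_nhdsGT_of_Icc_subset (s := x ⁻¹' C) ?_ h0 ?_
  · rw [inter_comm]
    exact hx.preimage_isClosed_of_isClosed isClosed_Icc hC
  · intro t ht hsub
    have h1 := h t ⟨ht.1, ht.2.le⟩ hsub
    have h2 := hx t ⟨ht.1, ht.2.le⟩ h1
    refine nhdsWithin_le_of_mem ?_ h2
    exact mem_of_superset (Ioo_mem_nhdsGT ht.2) (fun z hz => ⟨ht.1.trans hz.1.le, hz.2.le⟩)

/-- A field that is Lipschitz on a compact set, composed with a Lipschitz map into this set, is bounded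
and globally Lipschitz, so that the Picard–Lindelöf theorem gives solutions on all of `[0, T]`. -/
theorem exists_hasDerivWithinAt_comp_retraction {E : Type*} [NormedAddCommGroup E]
    [NormedSpace ℝ E] [CompleteSpace E] {f : E → E} {B : Set E} {P : E → E} {K K' : NNReal}
    (hB : IsCompact B) (hf : LipschitzOnWith K f B) (hP : LipschitzWith K' P)
    (hPB : ∀ x, P x ∈ B) (x₀ : E) {T : ℝ} (hT : 0 ≤ T) :
    ∃ x : ℝ → E, x 0 = x₀ ∧
      ∀ t ∈ Icc 0 T, HasDerivWithinAt x (f (P (x t))) (Icc 0 T) t := by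
  obtain ⟨L, hL⟩ := hB.exists_bound_of_continuousOn hf.continuousOn
  have hlip : LipschitzWith (K * K') (f ∘ P) := by
    rw [← lipschitzOnWith_univ] at hP ⊢
    exact hf.comp hP (fun x _ => hPB x)
  have hpl : IsPicardLindelof (fun _ : ℝ => f ∘ P) (⟨0, le_rfl, hT⟩ : Icc 0 T) x₀
      (L.toNNReal * T.toNNReal) 0 L.toNNReal (K * K') := by
    refine IsPicardLindelof.of_time_independent (fun x _ => ?_) hlip.lipschitzOnWith ?_
    · exact (hL _ (hPB x)).trans (Real.le_coe_toNNReal L)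
    · simp [hT]
  obtain ⟨x, hx0, hx⟩ := hpl.exists_eq_forall_mem_Icc_hasDerivWithinAt₀
  exact ⟨x, hx0, hx⟩

/-! ### The closed subsystem for `r₁` and `ε₁` -/

theorem rpow_neg_half_mul_sqrt_two : (2 : ℝ) ^ (-1 / 2 : ℝ) * Real.sqrt 2 = 1 := by
  rw [Real.sqrt_eq_rpow, ← Real.rpow_add two_pos]; norm_num

theorem rpow_neg_half_pos : 0 < (2 : ℝ) ^ (-1 / 2 : ℝ) := by positivity

namespace IsK1Solution

variable {k₀ : ℕ} {A : ℝ} {b : Mode k₀ → ℝ} {η : Mode k₀ → Mode k₀ → Mode k₀ → ℝ}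
  {H₁ : K1State k₀ → ℝ} {Hu Hv : Mode k₀ → K1State k₀ → ℝ} {τ : ℝ} {x : ℝ → K1State k₀}

theorem continuousOn (hx : IsK1Solution A b η H₁ Hu Hv τ x) : ContinuousOn x (Icc 0 τ) :=
  fun t ht => (hx t ht).continuousWithinAt

theorem mono (hx : IsK1Solution A b η H₁ Hu Hv τ x) {s : ℝ} (hs : s ≤ τ) :
    IsK1Solution A b η H₁ Hu Hv s x :=
  fun t ht => (hx t ⟨ht.1, ht.2.trans hs⟩).mono (Icc_subset_Icc_right hs)

theorem hasDerivWithinAt_clm {F : Type*} [NormedAddCommGroup F] [NormedSpace ℝ F]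
    (hx : IsK1Solution A b η H₁ Hu Hv τ x) (L : K1State k₀ →L[ℝ] F) {t : ℝ} (ht : t ∈ Icc 0 τ) :
    HasDerivWithinAt (fun t => L (x t)) (L (k1Field A b η H₁ Hu Hv (x t))) (Icc 0 τ) t :=
  L.hasFDerivAt.comp_hasDerivWithinAt t (hx t ht)

theorem hasDerivWithinAt_u₁ (hx : IsK1Solution A b η H₁ Hu Hv τ x) {t : ℝ} (ht : t ∈ Icc 0 τ) :
    HasDerivWithinAt (fun t => (x t).u₁) (k1Field A b η H₁ Hu Hv (x t)).u₁ (Icc 0 τ) t :=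
  hx.hasDerivWithinAt_clm (.fst ℝ _ _) ht

theorem hasDerivWithinAt_r (hx : IsK1Solution A b η H₁ Hu Hv τ x) {t : ℝ} (ht : t ∈ Icc 0 τ) :
    HasDerivWithinAt (fun t => (x t).r) (-((x t).r * k1F (x t).e)) (Icc 0 τ) t :=
  hx.hasDerivWithinAt_clm (.comp (.fst ℝ _ _) (.snd ℝ _ _)) ht

theorem hasDerivWithinAt_u (hx : IsK1Solution A b η H₁ Hu Hv τ x) {t : ℝ} (ht : t ∈ Icc 0 τ)
    (k : Mode k₀) :
    HasDerivWithinAt (fun t => (x t).u k) ((k1Field A b η H₁ Hu Hv (x t)).u k) (Icc 0 τ) t :=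
  hasDerivWithinAt_pi.1
    (hx.hasDerivWithinAt_clm (.comp (.fst ℝ _ _) (.comp (.snd ℝ _ _) (.snd ℝ _ _))) ht) k

theorem hasDerivWithinAt_v (hx : IsK1Solution A b η H₁ Hu Hv τ x) {t : ℝ} (ht : t ∈ Icc 0 τ)
    (k : Mode k₀) :
    HasDerivWithinAt (fun t => (x t).v k) ((k1Field A b η H₁ Hu Hv (x t)).v k) (Icc 0 τ) t :=
  hasDerivWithinAt_pi.1 (hx.hasDerivWithinAt_clm
    (.comp (.fst ℝ _ _) (.comp (.snd ℝ _ _) (.comp (.snd ℝ _ _) (.snd ℝ _ _)))) ht) k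

theorem hasDerivWithinAt_e (hx : IsK1Solution A b η H₁ Hu Hv τ x) {t : ℝ} (ht : t ∈ Icc 0 τ) :
    HasDerivWithinAt (fun t => (x t).e) (3 * k1F (x t).e * (x t).e) (Icc 0 τ) t :=
  hx.hasDerivWithinAt_clm
    (.comp (.snd ℝ _ _) (.comp (.snd ℝ _ _) (.comp (.snd ℝ _ _) (.snd ℝ _ _)))) ht

theorem e_ge (hx : IsK1Solution A b η H₁ Hu Hv τ x) {t : ℝ} (ht : t ∈ Icc 0 τ) :
    (x 0).e ≤ (x t).e := by
  refine (monotoneOn_of_hasDerivWithinAt_nonneg (convex_Icc 0 τ)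
    (fun t ht => (hx.hasDerivWithinAt_e ht).continuousWithinAt)
    (fun t ht => (hx.hasDerivWithinAt_e (interior_subset ht)).mono interior_subset)
    (fun t _ => ?_)) (left_mem_Icc.2 (ht.1.trans ht.2)) ht ht.1
  have : 3 * k1F (x t).e * (x t).e = 3 * ((2 : ℝ) ^ (-1 / 2 : ℝ) * (x t).e ^ 2) := by
    unfold k1F; ring
  rw [this]; positivity

/-- `1 / ε₁` decreases at the constant rate `3 / √2`. -/
theorem inv_e (hx : IsK1Solution A b η H₁ Hu Hv τ x) (h0 : 0 < (x 0).e) {t : ℝ}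
    (ht : t ∈ Icc 0 τ) :
    (x t).e⁻¹ = (x 0).e⁻¹ - 3 * (2 : ℝ) ^ (-1 / 2 : ℝ) * t := by
  have := eq_initial_of_hasDerivWithinAt_zero
    (f := fun t => (x t).e⁻¹ + 3 * (2 : ℝ) ^ (-1 / 2 : ℝ) * t) (τ := τ) (fun t ht => by
      have hpos := h0.trans_le (hx.e_ge ht)
      refine (((hx.hasDerivWithinAt_e ht).inv hpos.ne').add
        ((hasDerivWithinAt_id t _).const_mul (3 * (2 : ℝ) ^ (-1 / 2 : ℝ)))).congr_deriv ?_
      unfold k1F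
      field_simp
      ring) t ht
  simp only [mul_zero, add_zero] at this
  linarith

theorem e_le (hx : IsK1Solution A b η H₁ Hu Hv τ x) (h0 : 0 < (x 0).e) {δ : ℝ} (hδ : 0 < δ)
    (hτ : τ ≤ k1Time δ (x 0).e) {t : ℝ} (ht : t ∈ Icc 0 τ) : (x t).e ≤ δ := by
  have hpos := h0.trans_le (hx.e_ge ht)
  rw [← inv_le_inv₀ hδ hpos, hx.inv_e h0 ht]
  have h1 : 3 * (2 : ℝ) ^ (-1 / 2 : ℝ) * t
      ≤ 3 * (2 : ℝ) ^ (-1 / 2 : ℝ) * k1Time δ (x 0).e := by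
    have := ht.2.trans hτ
    gcongr
  have h2 : 3 * (2 : ℝ) ^ (-1 / 2 : ℝ) * k1Time δ (x 0).e = (x 0).e⁻¹ - δ⁻¹ := by
    unfold k1Time
    linear_combination ((x 0).e⁻¹ - δ⁻¹) * rpow_neg_half_mul_sqrt_two
  linarith

/-- `r₁³ ε₁` is a first integral. -/
theorem r_pow_three_mul_e (hx : IsK1Solution A b η H₁ Hu Hv τ x) {t : ℝ} (ht : t ∈ Icc 0 τ) :
    (x t).r ^ 3 * (x t).e = (x 0).r ^ 3 * (x 0).e := by
  refine eq_initial_of_hasDerivWithinAt_zero (f := fun t => (x t).r ^ 3 * (x t).e)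
    (fun t ht => ?_) t ht
  refine (((hx.hasDerivWithinAt_r ht).pow 3).mul (hx.hasDerivWithinAt_e ht)).congr_deriv ?_
  simp only [Pi.pow_apply]
  push_cast
  ring

theorem r_pos (hx : IsK1Solution A b η H₁ Hu Hv τ x) (h0 : 0 < (x 0).e) (hr : 0 < (x 0).r)
    {t : ℝ} (ht : t ∈ Icc 0 τ) : 0 < (x t).r := by
  have hpos := h0.trans_le (hx.e_ge ht)
  have h1 : 0 < (x t).r ^ 3 * (x t).e := by rw [hx.r_pow_three_mul_e ht]; positivity
  have h2 : 0 < (x t).r ^ 3 := pos_of_mul_pos_left h1 hpos.le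
  exact (Odd.pow_pos_iff (by decide)).1 h2

theorem r_le (hx : IsK1Solution A b η H₁ Hu Hv τ x) (h0 : 0 < (x 0).e) (hr : 0 < (x 0).r)
    {t : ℝ} (ht : t ∈ Icc 0 τ) : (x t).r ≤ (x 0).r := by
  have h1 := hx.r_pow_three_mul_e ht
  refine le_of_pow_le_pow_left₀ (n := 3) (by norm_num) hr.le ?_
  refine le_of_mul_le_mul_right ?_ h0
  rw [← h1]
  exact mul_le_mul_of_nonneg_left (hx.e_ge ht) (pow_pos (hx.r_pos h0 hr ht) 3).le

theorem mul_div_le_r (hx : IsK1Solution A b η H₁ Hu Hv τ x) (h0 : 0 < (x 0).e)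
    (hr : 0 < (x 0).r) {δ : ℝ} (hδ : 0 < δ) (hτ : τ ≤ k1Time δ (x 0).e) {t : ℝ}
    (ht : t ∈ Icc 0 τ) : (x 0).r * (x 0).e / δ ≤ (x t).r := by
  rw [div_le_iff₀ hδ]
  have hrt := hx.r_pos h0 hr ht
  have h1 := hx.r_pow_three_mul_e ht
  have h2 : (x t).r ^ 2 ≤ (x 0).r ^ 2 := pow_le_pow_left₀ hrt.le (hx.r_le h0 hr ht) 2
  refine le_of_mul_le_mul_left ?_ (pow_pos hr 2)
  calc (x 0).r ^ 2 * ((x 0).r * (x 0).e) = (x t).r ^ 2 * ((x t).r * (x t).e) := by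
        linear_combination -h1
    _ ≤ (x 0).r ^ 2 * ((x t).r * δ) := by
        have := hx.e_le h0 hδ hτ ht
        have := h0.trans_le (hx.e_ge ht)
        gcongr

end IsK1Solution

/-! ### Order symbols and damping rates near `p_a` -/

theorem rpow_quarter_pow_four : ((2 : ℝ) ^ (1 / 4 : ℝ)) ^ 4 = 2 := by
  rw [← Real.rpow_natCast, ← Real.rpow_mul two_pos.le]; norm_num

theorem rpow_quarter_mem_Icc : (2 : ℝ) ^ (1 / 4 : ℝ) ∈ Icc (1.1 : ℝ) 1.2 := by
  have h0 : (0 : ℝ) ≤ (2 : ℝ) ^ (1 / 4 : ℝ) := by positivity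
  have h4 := rpow_quarter_pow_four
  constructor
  · refine le_of_pow_le_pow_left₀ (n := 4) (by norm_num) h0 ?_
    rw [h4]; norm_num
  · refine le_of_pow_le_pow_left₀ (n := 4) (by norm_num) (by norm_num) ?_
    rw [h4]; norm_num

theorem rpow_neg_half_mul_rpow_quarter_sq :
    (2 : ℝ) ^ (-1 / 2 : ℝ) * ((2 : ℝ) ^ (1 / 4 : ℝ)) ^ 2 = 1 := by
  rw [← Real.rpow_natCast, ← Real.rpow_mul two_pos.le, ← Real.rpow_add two_pos]; norm_num

theorem rpow_neg_half_le_one : (2 : ℝ) ^ (-1 / 2 : ℝ) ≤ 1 :=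
  Real.rpow_le_one_of_one_le_of_nonpos one_le_two (by norm_num)

/-- The region `|u_{1,1} + 2^{1/4}| ≤ c`, `|u_{k,1}|, |v_{k,1}| ≤ c`, `0 < r₁, ε₁ ≤ c`; these sets
form a basis of the filter of neighbourhoods of `p_a` in `{r₁ > 0, ε₁ > 0}`. -/
def k1Box (k₀ : ℕ) (c : ℝ) : Set (K1State k₀) :=
  {x | |x.u₁ + (2 : ℝ) ^ (1 / 4 : ℝ)| ≤ c ∧ (0 < x.r ∧ x.r ≤ c) ∧ (∀ k, |x.u k| ≤ c) ∧
    (∀ k, |x.v k| ≤ c) ∧ 0 < x.e ∧ x.e ≤ c}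

theorem exists_k1Box_subset {k₀ : ℕ} {S : Set (K1State k₀)} (hS : S ∈ k1Near k₀) :
    ∃ c > 0, k1Box k₀ c ⊆ S := by
  obtain ⟨d, hd, hdS⟩ := Metric.mem_nhdsWithin_iff.1 hS
  refine ⟨d / 2, by positivity, fun x hx => hdS ⟨?_, hx.2.1.1, hx.2.2.2.2.1⟩⟩
  obtain ⟨h1, h2, h3, h4, h5⟩ := hx
  have hd2 : d / 2 < d := by linarith
  simp only [K1State.u₁, K1State.r, K1State.u, K1State.v, K1State.e] at h1 h2 h3 h4 h5
  simp only [Metric.mem_ball, k1SteadyState, Prod.dist_eq, max_lt_iff, Real.dist_eq,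
    dist_pi_lt_iff hd, sub_neg_eq_add, sub_zero, Pi.zero_apply]
  refine ⟨by linarith, ?_, fun k => ?_, fun k => ?_, ?_⟩
  · rw [abs_of_pos h2.1]; linarith
  · linarith [h3 k]
  · linarith [h4 k]
  · rw [abs_of_pos h5.1]; linarith

theorem k1Box_mono {k₀ : ℕ} {c c' : ℝ} (h : c ≤ c') : k1Box k₀ c ⊆ k1Box k₀ c' :=
  fun _ hx => ⟨hx.1.trans h, ⟨hx.2.1.1, hx.2.1.2.trans h⟩, fun k => (hx.2.2.1 k).trans h,
    fun k => (hx.2.2.2.1 k).trans h, hx.2.2.2.2.1, hx.2.2.2.2.2.trans h⟩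

/-- The number of modes, as a real number. -/
noncomputable def modeCard (k₀ : ℕ) : ℝ := Fintype.card (Mode k₀)

theorem modeCard_nonneg (k₀ : ℕ) : 0 ≤ modeCard k₀ := Nat.cast_nonneg _

theorem sum_le_modeCard_mul {k₀ : ℕ} {f : Mode k₀ → ℝ} {B : ℝ} (h : ∀ k, f k ≤ B) :
    ∑ k, f k ≤ modeCard k₀ * B := by
  simpa [modeCard] using Finset.sum_le_card_nsmul Finset.univ f B (fun k _ => h k)

/-- A constant bounding `orderU₁` and `orderU` by a multiple of `r₁` near `p_a`. -/
noncomputable def orderConst (k₀ : ℕ) : ℝ :=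
  8 + 4 * modeCard k₀ + 4 * modeCard k₀ ^ 2 + modeCard k₀ ^ 3

theorem orderConst_pos (k₀ : ℕ) : 0 < orderConst k₀ := by
  have := modeCard_nonneg k₀
  unfold orderConst; positivity

section

variable {k₀ : ℕ} {c : ℝ} {x : K1State k₀}

theorem abs_u₁_le_two (hc : c ≤ 1 / 10) (hx : x ∈ k1Box k₀ c) : |x.u₁| ≤ 2 := by
  have h := abs_le.1 hx.1
  have hq := rpow_quarter_mem_Icc
  rw [abs_le]
  constructor <;> linarith [hq.1, hq.2, h.1, h.2]

theorem orderU₁_le (hc : c ≤ 1 / 10) (hx : x ∈ k1Box k₀ c) :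
    orderU₁ x ≤ x.r * orderConst k₀ := by
  have hw := abs_u₁_le_two hc hx
  obtain ⟨-, ⟨hr, hr1⟩, hu, hv, he, he1⟩ := hx
  replace hr1 : x.r ≤ 1 := by linarith
  replace he1 : x.e ≤ 1 := by linarith
  replace hu : ∀ k, |x.u k| ≤ 1 := fun k => by linarith [hu k]
  replace hv : ∀ k, |x.v k| ≤ 1 := fun k => by linarith [hv k]
  unfold orderU₁
  simp only [abs_mul, abs_pow, abs_of_pos hr, abs_of_pos he]
  have h1 : x.r * x.e ≤ x.r * 1 := by gcongr
  have h2 : x.r ^ 2 ≤ x.r * 1 := by rw [sq]; gcongr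
  have h3 : ∑ j, x.r ^ 2 * |x.v j| ^ 2 ≤ modeCard k₀ * (x.r * 1 * 1 ^ 2) :=
    sum_le_modeCard_mul fun j => by
      have := hv j
      rw [sq x.r]; gcongr
  have h4 : x.r * |x.u₁| ≤ x.r * 2 := by gcongr
  have h5 : ∑ j, x.r * |x.u j| * |x.v j| ≤ modeCard k₀ * (x.r * 1 * 1) :=
    sum_le_modeCard_mul fun j => by
      have := hv j
      have := hu j
      gcongr
  have h6 : ∑ j, x.r * |x.u₁| * |x.u j| ^ 2 ≤ modeCard k₀ * (x.r * 2 * 1 ^ 2) :=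
    sum_le_modeCard_mul fun j => by
      have := hu j
      gcongr
  have h7 : ∑ i, ∑ j, ∑ l, x.r * |x.u j| * |x.u i| * |x.u l|
      ≤ modeCard k₀ * (modeCard k₀ * (modeCard k₀ * (x.r * 1 * 1 * 1))) :=
    sum_le_modeCard_mul fun i => sum_le_modeCard_mul fun j => sum_le_modeCard_mul fun l => by
      have := hu i
      have := hu j
      have := hu l
      gcongr
  have h8 := mul_nonneg hr.le (sq_nonneg (modeCard k₀))
  unfold orderConst
  nlinarith

theorem orderU_le (hc : c ≤ 1 / 10) (hx : x ∈ k1Box k₀ c) (k : Mode k₀) :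
    orderU k x ≤ x.r * orderConst k₀ := by
  have hw := abs_u₁_le_two hc hx
  obtain ⟨-, ⟨hr, hr1⟩, hu, hv, -, -⟩ := hx
  replace hr1 : x.r ≤ 1 := by linarith
  replace hu : ∀ k, |x.u k| ≤ 1 := fun k => by linarith [hu k]
  replace hv : ∀ k, |x.v k| ≤ 1 := fun k => by linarith [hv k]
  unfold orderU
  simp only [abs_mul, abs_pow, abs_of_pos hr]
  have huk := hu k
  have hvk := hv k
  have h1 : x.r ^ 2 * |x.v k| ≤ x.r * 1 * 1 := by rw [sq]; gcongr
  have h2 : ∑ i, ∑ j, x.r ^ 2 * |x.v i| * |x.v j|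
      ≤ modeCard k₀ * (modeCard k₀ * (x.r * 1 * 1 * 1)) :=
    sum_le_modeCard_mul fun i => sum_le_modeCard_mul fun j => by
      have := hv i
      have := hv j
      rw [sq x.r]; gcongr
  have h3 : x.r * |x.u₁| * |x.v k| ≤ x.r * 2 * 1 := by gcongr
  have h4 : x.r * |x.u k| ≤ x.r * 1 := by gcongr
  have h5 : ∑ i, ∑ j, x.r * |x.u i| * |x.v j| ≤ modeCard k₀ * (modeCard k₀ * (x.r * 1 * 1)) :=
    sum_le_modeCard_mul fun i => sum_le_modeCard_mul fun j => by
      have := hu i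
      have := hv j
      gcongr
  have h6 : x.r * |x.u₁| ^ 2 * |x.u k| ≤ x.r * 2 ^ 2 * 1 := by gcongr
  have h7 : ∑ i, ∑ j, x.r * |x.u₁| * |x.u i| * |x.u j|
      ≤ modeCard k₀ * (modeCard k₀ * (x.r * 2 * 1 * 1)) :=
    sum_le_modeCard_mul fun i => sum_le_modeCard_mul fun j => by
      have := hu i
      have := hu j
      gcongr
  have h8 : ∑ i, ∑ j, ∑ l, x.r * |x.u j| * |x.u i| * |x.u l|
      ≤ modeCard k₀ * (modeCard k₀ * (modeCard k₀ * (x.r * 1 * 1 * 1))) :=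
    sum_le_modeCard_mul fun i => sum_le_modeCard_mul fun j => sum_le_modeCard_mul fun l => by
      have := hu i
      have := hu j
      have := hu l
      gcongr
  have h9 := mul_nonneg hr.le (modeCard_nonneg k₀)
  unfold orderConst
  nlinarith

end

/-- On the level set `r₁³ ε₁ = ε`, the scaling `A = ε^{1/6} a` turns the damping rate of `u_{k,1}` into
`|b_k| / (4 a² r₁)`, which is bounded below because `r₁` decreases. -/
theorem damping_u {r e ε A a : ℝ} (hr : 0 < r) (he : 0 < e) (ha : 0 < a) (hε : r ^ 3 * e = ε)
    (hA : A = ε ^ (1 / 6 : ℝ) * a) (b : ℝ) :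
    b / (4 * A ^ 2) * e ^ (1 / 3 : ℝ) = b / (4 * a ^ 2 * r) := by
  have h1 : (ε ^ (1 / 6 : ℝ)) ^ 2 = r * e ^ (1 / 3 : ℝ) := by
    have hεp : 0 < ε := by rw [← hε]; positivity
    rw [← Real.rpow_natCast, ← Real.rpow_mul hεp.le, ← hε, Real.mul_rpow (by positivity) he.le,
      ← Real.rpow_natCast, ← Real.rpow_mul hr.le]
    norm_num
  have h2 : 0 < e ^ (1 / 3 : ℝ) := by positivity
  rw [hA, mul_pow, h1]
  field_simp

/-- The counterpart of `damping_u` for `v_{k,1}`: the rate becomes `|b_k| r₁² ε₁ / (4 a²)`, which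
dominates the remainder `ε₁ O(r₁⁴ v_{k,1})` for small `r₁`. -/
theorem damping_v {r e ε A a : ℝ} (hr : 0 < r) (he : 0 < e) (ha : 0 < a) (hε : r ^ 3 * e = ε)
    (hA : A = ε ^ (1 / 6 : ℝ) * a) (b : ℝ) :
    b / (4 * A ^ 2) * r ^ 3 * e ^ (4 / 3 : ℝ) = b / (4 * a ^ 2) * (r ^ 2 * e) := by
  have h1 : e ^ (4 / 3 : ℝ) = e ^ (1 / 3 : ℝ) * e := by
    rw [← Real.rpow_add_one he.ne']; norm_num
  have h2 := damping_u hr he ha hε hA b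
  calc b / (4 * A ^ 2) * r ^ 3 * e ^ (4 / 3 : ℝ)
      = (b / (4 * A ^ 2) * e ^ (1 / 3 : ℝ)) * r ^ 3 * e := by rw [h1]; ring
    _ = b / (4 * a ^ 2) * (r ^ 2 * e) := by rw [h2]; field_simp

/-! ### A priori estimates for the single coordinates -/

namespace IsK1Solution

variable {k₀ : ℕ} {A : ℝ} {b : Mode k₀ → ℝ} {η : Mode k₀ → Mode k₀ → Mode k₀ → ℝ}
  {H₁ : K1State k₀ → ℝ} {Hu Hv : Mode k₀ → K1State k₀ → ℝ} {s : ℝ} {x : ℝ → K1State k₀}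

/-- The linearisation at `p_a` contracts the `u_{1,1}` direction, so that `u_{1,1}` stays within `c / 2`
of its steady state when the remaining terms are small. -/
theorem abs_u₁_add_le (hx : IsK1Solution A b η H₁ Hu Hv s x) {c K ρ δ : ℝ} (hc : 0 < c)
    (hc1 : c ≤ 1 / 10) (hcN : modeCard k₀ * c ≤ 1 / 8) (hK : 0 ≤ K)
    (hρ : K * (ρ * orderConst k₀) ≤ c / 8) (hδ : δ ≤ c / 16)
    (hH : ∀ y ∈ k1Box k₀ c, |H₁ y| ≤ K * orderU₁ y)
    (hbox : ∀ t ∈ Icc 0 s, x t ∈ k1Box k₀ c)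
    (hr : ∀ t ∈ Icc 0 s, (x t).r ≤ ρ) (he : ∀ t ∈ Icc 0 s, (x t).e ≤ δ)
    (h0 : |(x 0).u₁ + (2 : ℝ) ^ (1 / 4 : ℝ)| ≤ c / 2) :
    ∀ t ∈ Icc 0 s, |(x t).u₁ + (2 : ℝ) ^ (1 / 4 : ℝ)| ≤ c / 2 := by
  refine abs_le_of_mul_deriv_nonpos
    (fun t ht => (hx.hasDerivWithinAt_u₁ ht).add_const ((2 : ℝ) ^ (1 / 4 : ℝ))) h0 ?_
  intro t ht hlarge
  have hb := hbox t ht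
  have hw := abs_u₁_le_two hc1 hb
  have hHt := (hH _ hb).trans (mul_le_mul_of_nonneg_left (orderU₁_le hc1 hb) hK)
  have hM := orderConst_pos k₀
  have hHt' : |H₁ (x t)| ≤ c / 8 := by
    refine hHt.trans (le_trans ?_ hρ)
    have := hr t ht
    gcongr
  have heδ := he t ht
  obtain ⟨hy, -, hu, -, hepos, -⟩ := hb
  have hsum : ∑ j, (x t).u j ^ 2 ≤ c / 8 := by
    have : ∑ j, (x t).u j ^ 2 ≤ modeCard k₀ * (c * c) := sum_le_modeCard_mul fun j => by
      rw [← sq, ← sq_abs]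
      have := hu j
      gcongr
    nlinarith
  have hsum0 : 0 ≤ ∑ j, (x t).u j ^ 2 := Finset.sum_nonneg fun j _ => sq_nonneg _
  have hq := rpow_quarter_mem_Icc
  have hs1 := rpow_neg_half_le_one
  have hs0 := rpow_neg_half_pos
  have hsq := rpow_neg_half_mul_rpow_quarter_sq
  change ((x t).u₁ + _) * (k1F (x t).e * (x t).u₁ - 1 + (2 : ℝ) ^ (-1 / 2 : ℝ) * (x t).u₁ ^ 2
      + (2 : ℝ) ^ (-1 / 2 : ℝ) * (∑ j, (x t).u j ^ 2) + H₁ (x t)) ≤ 0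
  unfold k1F
  generalize (2 : ℝ) ^ (-1 / 2 : ℝ) = σ at *
  generalize (2 : ℝ) ^ (1 / 4 : ℝ) = q at *
  generalize ∑ j, (x t).u j ^ 2 = S at *
  generalize H₁ (x t) = H at *
  generalize (x t).e = e at *
  generalize (x t).u₁ = w at *
  obtain ⟨y, rfl⟩ : ∃ y, w = y - q := ⟨w + q, by ring⟩
  rw [sub_add_cancel] at *
  -- the part of the equation that is not linear in `y = u_{1,1} + 2^{1/4}`
  set R := σ * e * (y - q) + σ * S + H with hR
  have hRle : |R| ≤ 3 / 8 * c := by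
    have hδ0 : 0 ≤ δ := hepos.le.trans heδ
    have h1 : |σ * e * (y - q)| ≤ 1 * δ * 2 := by
      rw [abs_mul, abs_mul, abs_of_pos hs0, abs_of_pos hepos]
      gcongr
    have h2 : |σ * S| ≤ 1 * (c / 8) := by
      rw [abs_mul, abs_of_pos hs0, abs_of_nonneg hsum0]
      gcongr
    calc |R| ≤ |σ * e * (y - q)| + |σ * S| + |H| := abs_add_three _ _ _
      _ ≤ 3 / 8 * c := by linarith
  have hlin : 1 ≤ 2 * (σ * q) := by
    have h1 : σ * q * q = 1 := by rw [← hsq]; ring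
    have h2 : 0 < σ * q := mul_pos hs0 (by linarith [hq.1])
    nlinarith [hq.2]
  have hexp : y * (σ * e * (y - q) - 1 + σ * (y - q) ^ 2 + σ * S + H)
      = -(2 * (σ * q)) * |y| ^ 2 + σ * y * |y| ^ 2 + y * R := by
    rw [sq_abs]; linear_combination y * hsq
  rw [hexp]
  have hy0 := abs_nonneg y
  have h3 : y * R ≤ |y| * (3 / 8 * c) := (le_abs_self _).trans (by rw [abs_mul]; gcongr)
  have h4 : σ * y ≤ 1 / 10 := by
    calc σ * y ≤ σ * |y| := by gcongr; exact le_abs_self y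
      _ ≤ 1 * (1 / 10) := by gcongr; linarith
      _ = 1 / 10 := one_mul _
  nlinarith [mul_nonneg hy0 hy0, mul_le_mul_of_nonneg_left hlarge hy0,
    mul_le_mul_of_nonneg_right h4 (sq_nonneg |y|), mul_le_mul_of_nonneg_right hlin (sq_nonneg |y|)]

/-- Within the box, all terms of the equation for `u_{k,1}` other than the damping and
`(F₁ + √2 u_{1,1}) u_{k,1}` have sum at most `1`, while the damping rate is at least
`|b_k| / (4 a² ρ)`. -/
theorem abs_u_le (hx : IsK1Solution A b η H₁ Hu Hv s x) {c K E ρ ε a : ℝ} (ha : 0 < a)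
    (hb : ∀ k, b k < 0) (hc : 0 < c)
    (hc1 : c ≤ 1 / 10) (hcE : E * (modeCard k₀ * c) ^ 2 ≤ 1 / 8) (hK : 0 ≤ K)
    (hη : ∀ k i j, |η k i j| ≤ E) (hρ : K * (ρ * orderConst k₀) ≤ 1 / 8)
    (hA : A = ε ^ (1 / 6 : ℝ) * a)
    (hH : ∀ k, ∀ y ∈ k1Box k₀ c, |Hu k y| ≤ K * orderU k y)
    (hbox : ∀ t ∈ Icc 0 s, x t ∈ k1Box k₀ c)
    (hr : ∀ t ∈ Icc 0 s, (x t).r ≤ ρ) (hε : ∀ t ∈ Icc 0 s, (x t).r ^ 3 * (x t).e = ε)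
    (k : Mode k₀) :
    ∀ t ∈ Icc 0 s, |(x t).u k| ≤ |(x 0).u k| + 4 * a ^ 2 * ρ / |b k| := by
  intro t₁ ht₁
  have hρ0 : 0 ≤ ρ := (hbox t₁ ht₁).2.1.1.le.trans (hr t₁ ht₁)
  refine abs_le_of_mul_deriv_nonpos (fun t ht => hx.hasDerivWithinAt_u ht k)
    (le_add_of_nonneg_right (by positivity)) ?_ t₁ ht₁
  intro t ht hlarge
  have hbk : 0 < |b k| := abs_pos.2 (hb k).ne
  replace hlarge : 4 * a ^ 2 * ρ / |b k| ≤ |(x t).u k| :=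
    (le_add_of_nonneg_left (abs_nonneg _)).trans hlarge
  have hbx := hbox t ht
  have hHt := (hH k _ hbx).trans (mul_le_mul_of_nonneg_left (orderU_le hc1 hbx k) hK)
  have hM := orderConst_pos k₀
  have hrρ := hr t ht
  have hHt' : |Hu k (x t)| ≤ 1 / 8 := by
    refine hHt.trans (le_trans ?_ hρ)
    gcongr
  obtain ⟨hy, ⟨hrpos, -⟩, hu, hv, hepos, he1⟩ := hbx
  have hE0 : 0 ≤ E := (abs_nonneg _).trans (hη k k k)
  have hquad : |∑ i, ∑ j, η k i j * (x t).u i * (x t).u j| ≤ 1 / 8 := by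
    refine (Finset.abs_sum_le_sum_abs _ _).trans (le_trans (b :=
      modeCard k₀ * (modeCard k₀ * (E * c * c))) ?_ (le_trans (le_of_eq (by ring)) hcE))
    refine sum_le_modeCard_mul fun i => (Finset.abs_sum_le_sum_abs _ _).trans ?_
    refine sum_le_modeCard_mul fun j => ?_
    rw [abs_mul, abs_mul]
    have := hη k i j
    have := hu i
    have := hu j
    gcongr
  have hq := rpow_quarter_mem_Icc
  have hs1 := rpow_neg_half_le_one
  change (x t).u k * (k1F (x t).e * (x t).u k + b k / (4 * A ^ 2) * (x t).e ^ (1 / 3 : ℝ) * (x t).u k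
    - (x t).v k + (2 : ℝ) ^ (1 / 2 : ℝ) * (x t).u₁ * (x t).u k
    + (∑ i, ∑ j, η k i j * (x t).u i * (x t).u j) + Hu k (x t)) ≤ 0
  rw [damping_u hrpos hepos ha (hε t ht) hA]
  -- the coefficient `F₁ + √2 u_{1,1}` is negative near `p_a`
  have hcoef : k1F (x t).e + (2 : ℝ) ^ (1 / 2 : ℝ) * (x t).u₁ ≤ 0 := by
    have h1 : k1F (x t).e ≤ 1 * (1 / 10) := by
      unfold k1F
      have : (x t).e ≤ 1 / 10 := by linarith
      gcongr
    have h2 : (1 : ℝ) ≤ (2 : ℝ) ^ (1 / 2 : ℝ) := Real.one_le_rpow one_le_two (by norm_num)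
    have h3 : (x t).u₁ ≤ -1 := by linarith [(abs_le.1 hy).2, hq.1]
    nlinarith
  have hdamp : 1 ≤ |b k| / (4 * a ^ 2 * (x t).r) * |(x t).u k| := by
    calc 1 = |b k| / (4 * a ^ 2 * (x t).r) * (4 * a ^ 2 * (x t).r / |b k|) := by
          field_simp
      _ ≤ |b k| / (4 * a ^ 2 * (x t).r) * |(x t).u k| := by
          gcongr
          refine le_trans ?_ hlarge
          gcongr
  have hbneg : b k = -|b k| := by rw [abs_of_neg (hb k)]; ring
  have hvk := hv k
  rw [hbneg]
  generalize ∑ i, ∑ j, η k i j * (x t).u i * (x t).u j = Q at *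
  generalize Hu k (x t) = H at *
  generalize (x t).v k = v at *
  generalize (x t).u k = y at *
  generalize k1F (x t).e = F at *
  generalize (2 : ℝ) ^ (1 / 2 : ℝ) * (x t).u₁ = G at *
  rw [neg_div]
  generalize |b k| / (4 * a ^ 2 * (x t).r) = D at *
  have hR : |-v + Q + H| ≤ 1 := by
    have := abs_add_three (-v) Q H
    rw [abs_neg] at this
    linarith
  have h3 : y * (-v + Q + H) ≤ |y| * 1 := (le_abs_self _).trans (by rw [abs_mul]; gcongr)
  have hexp : y * (F * y + -D * y - v + G * y + Q + H)
      = (F + G) * y ^ 2 - |y| * (D * |y|) + y * (-v + Q + H) := by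
    linear_combination D * (sq_abs y)
  rw [hexp]
  nlinarith [mul_nonneg (neg_nonneg.2 hcoef) (sq_nonneg y),
    mul_le_mul_of_nonneg_left hdamp (abs_nonneg y)]

/-- For `W_k = r₁² v_{k,1}` the growth term `2 F₁` disappears, and the quadratic part of the remainder
is, relative to the damping, of size `(∑ |W_i|)²`; a bound `|W_i| ≤ c h` therefore improves to one of
order `h²`. -/
theorem abs_r_sq_mul_v_le (hx : IsK1Solution A b η H₁ Hu Hv s x) {c h K ρ ε a : ℝ} (ha : 0 < a)
    (hb : ∀ k, b k < 0) (hK : 0 ≤ K)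
    (hcK : K * (modeCard k₀ * c) ^ 2 ≤ 1 / 2) (hρ : ∀ k, K * ρ ^ 2 ≤ |b k| / (8 * a ^ 2))
    (hA : A = ε ^ (1 / 6 : ℝ) * a)
    (hH : ∀ k, ∀ t ∈ Icc 0 s, |Hv k (x t)| ≤ K * orderV k (x t))
    (hrpos : ∀ t ∈ Icc 0 s, 0 < (x t).r) (hepos : ∀ t ∈ Icc 0 s, 0 < (x t).e)
    (hr : ∀ t ∈ Icc 0 s, (x t).r ≤ ρ) (hε : ∀ t ∈ Icc 0 s, (x t).r ^ 3 * (x t).e = ε)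
    (hW : ∀ t ∈ Icc 0 s, ∀ k, |(x t).r ^ 2 * (x t).v k| ≤ c * h) (k : Mode k₀) :
    ∀ t ∈ Icc 0 s, |(x t).r ^ 2 * (x t).v k|
      ≤ |(x 0).r ^ 2 * (x 0).v k| + 4 * a ^ 2 / |b k| * h ^ 2 := by
  refine abs_le_of_mul_deriv_nonpos
    (fun t ht => ((hx.hasDerivWithinAt_r ht).pow 2).mul (hx.hasDerivWithinAt_v ht k))
    (le_add_of_nonneg_right (by positivity)) ?_
  intro t ht hlarge
  have hbk : 0 < |b k| := abs_pos.2 (hb k).ne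
  replace hlarge : 4 * a ^ 2 / |b k| * h ^ 2 ≤ |(x t).r ^ 2 * (x t).v k| :=
    (le_add_of_nonneg_left (abs_nonneg _)).trans hlarge
  have hHt := hH k t ht
  have hr0 := hrpos t ht
  have he0 := hepos t ht
  have hWt := hW t ht
  have hord : (x t).r ^ 2 * orderV k (x t) = (x t).r ^ 2 *
      ((x t).r ^ 2 * |(x t).r ^ 2 * (x t).v k|
        + ∑ i, ∑ j, |(x t).r ^ 2 * (x t).v i| * |(x t).r ^ 2 * (x t).v j|) := by
    unfold orderV
    simp only [abs_mul, abs_pow, abs_of_pos hr0]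
    congr 1
    congr 1
    · ring
    · exact Finset.sum_congr rfl fun i _ => Finset.sum_congr rfl fun j _ => by ring
  have hsum : ∑ i, ∑ j, |(x t).r ^ 2 * (x t).v i| * |(x t).r ^ 2 * (x t).v j|
      ≤ modeCard k₀ * (modeCard k₀ * (c * h * (c * h))) :=
    sum_le_modeCard_mul fun i => sum_le_modeCard_mul fun j => by
      have h1 := hWt i
      have h2 := hWt j
      have h3 := (abs_nonneg _).trans h1
      gcongr
  have hrρ := pow_le_pow_left₀ hr0.le (hr t ht) 2
  have hforce : (x t).r ^ 2 * |Hv k (x t)| ≤ (x t).r ^ 2 *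
      (|b k| / (8 * a ^ 2) * |(x t).r ^ 2 * (x t).v k| + h ^ 2 / 2) := by
    calc (x t).r ^ 2 * |Hv k (x t)| ≤ (x t).r ^ 2 * (K * orderV k (x t)) := by gcongr
      _ = K * ((x t).r ^ 2 * orderV k (x t)) := by ring
      _ = (x t).r ^ 2 * (K * (x t).r ^ 2 * |(x t).r ^ 2 * (x t).v k|
          + K * ∑ i, ∑ j, |(x t).r ^ 2 * (x t).v i| * |(x t).r ^ 2 * (x t).v j|) := by
          rw [hord]; ring
      _ ≤ (x t).r ^ 2 * (|b k| / (8 * a ^ 2) * |(x t).r ^ 2 * (x t).v k| + h ^ 2 / 2) := by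
          refine mul_le_mul_of_nonneg_left (add_le_add ?_ ?_) (sq_nonneg _)
          · exact mul_le_mul_of_nonneg_right
              ((mul_le_mul_of_nonneg_left hrρ hK).trans (hρ k)) (abs_nonneg _)
          · calc _ ≤ K * (modeCard k₀ * (modeCard k₀ * (c * h * (c * h)))) := by gcongr
              _ = K * (modeCard k₀ * c) ^ 2 * h ^ 2 := by ring
              _ ≤ 1 / 2 * h ^ 2 := by gcongr
              _ = h ^ 2 / 2 := by ring
  have hdamp : h ^ 2 ≤ |b k| / (4 * a ^ 2) * |(x t).r ^ 2 * (x t).v k| := by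
    calc h ^ 2 = |b k| / (4 * a ^ 2) * (4 * a ^ 2 / |b k| * h ^ 2) := by field_simp
      _ ≤ _ := by gcongr
  have hbneg : b k = -|b k| := by rw [abs_of_neg (hb k)]; ring
  have hfield : (k1Field A b η H₁ Hu Hv (x t)).v k = 2 * k1F (x t).e * (x t).v k
      + b k / (4 * a ^ 2) * ((x t).r ^ 2 * (x t).e) * (x t).v k + (x t).e * Hv k (x t) := by
    rw [← damping_v hr0 he0 ha (hε t ht) hA]; rfl
  -- the growth `2 F₁` of `v_{k,1}` cancels against the decay of `r₁²`
  have hexp : (x t).r ^ 2 * (x t).v k *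
      ((2 * (x t).r * -((x t).r * k1F (x t).e)) * (x t).v k
        + (x t).r ^ 2 * (k1Field A b η H₁ Hu Hv (x t)).v k)
      = (x t).e * (-((x t).r ^ 2 * (|b k| / (4 * a ^ 2)) * |(x t).r ^ 2 * (x t).v k| ^ 2)
        + (x t).r ^ 2 * (x t).v k * ((x t).r ^ 2 * Hv k (x t))) := by
    rw [hfield, hbneg, sq_abs, abs_neg, abs_abs]
    ring
  simp only [Pi.pow_apply]
  push_cast
  rw [pow_one, hexp]
  refine mul_nonpos_of_nonneg_of_nonpos he0.le ?_
  have h3 : (x t).r ^ 2 * (x t).v k * ((x t).r ^ 2 * Hv k (x t))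
      ≤ |(x t).r ^ 2 * (x t).v k| * ((x t).r ^ 2 *
      (|b k| / (8 * a ^ 2) * |(x t).r ^ 2 * (x t).v k| + h ^ 2 / 2)) := by
    refine (le_abs_self _).trans ?_
    rw [abs_mul _ ((x t).r ^ 2 * Hv k (x t)), abs_mul _ (Hv k (x t)),
      abs_of_nonneg (sq_nonneg (x t).r)]
    gcongr
  have h4 : |b k| / (8 * a ^ 2) = |b k| / (4 * a ^ 2) / 2 := by field_simp; norm_num
  rw [h4] at h3
  have h5 := mul_le_mul_of_nonneg_left hdamp
    (mul_nonneg (sq_nonneg (x t).r) (abs_nonneg ((x t).r ^ 2 * (x t).v k)))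
  nlinarith

end IsK1Solution

/-! ### Lipschitz continuity and truncation of the field -/

theorem exists_lipschitzOnWith_pi {ι X : Type*} [Fintype ι] [PseudoEMetricSpace X] {s : Set X}
    {f : ι → X → ℝ} (hf : ∀ i, ∃ K, LipschitzOnWith K (f i) s) :
    ∃ K, LipschitzOnWith K (fun x i => f i x) s := by
  choose K hK using hf
  refine ⟨Finset.univ.sup K, fun x hx y hy => edist_pi_le_iff.2 fun i => ?_⟩
  exact (hK i).weaken (Finset.le_sup (Finset.mem_univ i)) hx hy

theorem exists_lipschitzOnWith_rpow_e {k₀ : ℕ} {B : Set (K1State k₀)} (hB : IsCompact B)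
    (hBc : Convex ℝ B) (he : ∀ x ∈ B, 0 < x.e) (p : ℝ) :
    ∃ K, LipschitzOnWith K (fun x : K1State k₀ => x.e ^ p) B := by
  refine LocallyLipschitzOn.exists_lipschitzOnWith_of_compact hB
    (ContDiffOn.locallyLipschitzOn hBc ?_)
  refine ContDiffOn.rpow_const_of_ne ?_ (fun x hx => (he x hx).ne')
  unfold K1State.e
  fun_prop

theorem exists_lipschitzOnWith_k1Field {k₀ : ℕ} {A : ℝ} {b : Mode k₀ → ℝ}
    {η : Mode k₀ → Mode k₀ → Mode k₀ → ℝ} {H₁ : K1State k₀ → ℝ} {Hu Hv : Mode k₀ → K1State k₀ → ℝ}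
    {B : Set (K1State k₀)} (hB : IsCompact B) (hBc : Convex ℝ B) (he : ∀ x ∈ B, 0 < x.e)
    (h₁ : LocallyLipschitzOn B H₁) (hu : ∀ k, LocallyLipschitzOn B (Hu k))
    (hv : ∀ k, LocallyLipschitzOn B (Hv k)) :
    ∃ K, LipschitzOnWith K (k1Field A b η H₁ Hu Hv) B := by
  obtain ⟨K₁, h₁⟩ := h₁.exists_lipschitzOnWith_of_compact hB
  obtain ⟨K₂, hu⟩ := exists_lipschitzOnWith_pi fun k => (hu k).exists_lipschitzOnWith_of_compact hB
  obtain ⟨K₃, hv⟩ := exists_lipschitzOnWith_pi fun k => (hv k).exists_lipschitzOnWith_of_compact hB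
  obtain ⟨K₄, hp⟩ := exists_lipschitzOnWith_rpow_e hB hBc he (1 / 3)
  obtain ⟨K₅, hq⟩ := exists_lipschitzOnWith_rpow_e hB hBc he (4 / 3)
  -- the field is a polynomial `Φ` in the state, the two fractional powers and the remainders
  let Φ : K1State k₀ × ℝ × ℝ × ℝ × (Mode k₀ → ℝ) × (Mode k₀ → ℝ) → K1State k₀ := fun z =>
    ( k1F z.1.e * z.1.u₁ - 1 + (2 : ℝ) ^ (-1 / 2 : ℝ) * z.1.u₁ ^ 2
        + (2 : ℝ) ^ (-1 / 2 : ℝ) * (∑ j, z.1.u j ^ 2) + z.2.2.2.1,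
      -(z.1.r * k1F z.1.e),
      fun k => k1F z.1.e * z.1.u k + b k / (4 * A ^ 2) * z.2.1 * z.1.u k - z.1.v k
        + (2 : ℝ) ^ (1 / 2 : ℝ) * z.1.u₁ * z.1.u k + (∑ i, ∑ j, η k i j * z.1.u i * z.1.u j)
        + z.2.2.2.2.1 k,
      fun k => 2 * k1F z.1.e * z.1.v k + b k / (4 * A ^ 2) * z.1.r ^ 3 * z.2.2.1 * z.1.v k
        + z.1.e * z.2.2.2.2.2 k,
      3 * k1F z.1.e * z.1.e )
  have hΦ : ContDiff ℝ 1 Φ := by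
    unfold Φ k1F K1State.e K1State.r K1State.u K1State.v K1State.u₁
    fun_prop
  have hg := LipschitzWith.id.lipschitzOnWith (s := B) |>.prodMk
    (hp.prodMk (hq.prodMk (h₁.prodMk (hu.prodMk hv))))
  obtain ⟨K, hK⟩ := (hΦ.locallyLipschitz.locallyLipschitzOn).exists_lipschitzOnWith_of_compact
    (hB.image_of_continuousOn hg.continuousOn)
  have hfield : k1Field A b η H₁ Hu Hv = fun x => Φ (x, x.e ^ (1 / 3 : ℝ), x.e ^ (4 / 3 : ℝ),
      H₁ x, (fun k => Hu k x), fun k => Hv k x) := rfl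
  rw [hfield]
  exact ⟨_, hK.comp hg (mapsTo_image _ _)⟩

/-- The coordinatewise projection of the phase space onto the order interval `[lo, hi]`. -/
noncomputable def k1Clamp {k₀ : ℕ} (lo hi x : K1State k₀) : K1State k₀ := lo ⊔ (hi ⊓ x)

theorem k1Clamp_mem {k₀ : ℕ} {lo hi : K1State k₀} (h : lo ≤ hi) (x : K1State k₀) :
    k1Clamp lo hi x ∈ Icc lo hi := ⟨le_sup_left, sup_le h inf_le_left⟩

theorem k1Clamp_of_mem {k₀ : ℕ} {lo hi x : K1State k₀} (h : x ∈ Icc lo hi) :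
    k1Clamp lo hi x = x := by
  rw [k1Clamp, inf_eq_right.2 h.2, sup_eq_right.2 h.1]

theorem lipschitzWith_k1Clamp {k₀ : ℕ} (lo hi : K1State k₀) : LipschitzWith 1 (k1Clamp lo hi) := by
  have h : ∀ a b x y : ℝ, dist (a ⊔ (b ⊓ x)) (a ⊔ (b ⊓ y)) ≤ dist x y := fun a b x y => by
    have := (LipschitzWith.id.const_min b).const_max a |>.dist_le_mul x y
    simpa using this
  refine LipschitzWith.of_dist_le_mul fun x y => ?_
  rw [NNReal.coe_one, one_mul]
  simp only [Prod.dist_eq]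
  refine max_le_max (h _ _ _ _) (max_le_max (h _ _ _ _) (max_le_max ?_ (max_le_max ?_ (h _ _ _ _))))
  · exact (dist_pi_le_iff dist_nonneg).2 fun k => (h _ _ _ _).trans (dist_le_pi_dist _ _ k)
  · exact (dist_pi_le_iff dist_nonneg).2 fun k => (h _ _ _ _).trans (dist_le_pi_dist _ _ k)

/-! ### The trapping region and the choice of constants -/

/-- The lower corner of the compact box to which the solutions are confined. -/
noncomputable def k1Lower (k₀ : ℕ) (c r₁ e₁ : ℝ) : K1State k₀ :=
  (-(2 : ℝ) ^ (1 / 4 : ℝ) - c, r₁, fun _ => -c, fun _ => -c, e₁)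

/-- The upper corner of the compact box to which the solutions are confined. -/
noncomputable def k1Upper (k₀ : ℕ) (c : ℝ) : K1State k₀ :=
  (-(2 : ℝ) ^ (1 / 4 : ℝ) + c, c, fun _ => c, fun _ => c, c)

theorem mem_Icc_k1Lower_k1Upper {k₀ : ℕ} {c r₁ e₁ : ℝ} {x : K1State k₀} :
    x ∈ Icc (k1Lower k₀ c r₁ e₁) (k1Upper k₀ c) ↔
      |x.u₁ + (2 : ℝ) ^ (1 / 4 : ℝ)| ≤ c ∧ (r₁ ≤ x.r ∧ x.r ≤ c) ∧ (∀ k, |x.u k| ≤ c) ∧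
        (∀ k, |x.v k| ≤ c) ∧ e₁ ≤ x.e ∧ x.e ≤ c := by
  simp only [mem_Icc, Prod.le_def, Pi.le_def, k1Lower, k1Upper, K1State.u₁, K1State.r, K1State.u,
    K1State.v, K1State.e, abs_le]
  constructor
  · rintro ⟨⟨h1, h2, h3, h4, h5⟩, h6, h7, h8, h9, h10⟩
    exact ⟨⟨by linarith, by linarith⟩, ⟨h2, h7⟩, fun k => ⟨h3 k, h8 k⟩, fun k => ⟨h4 k, h9 k⟩, h5, h10⟩
  · rintro ⟨⟨h1, h6⟩, ⟨h2, h7⟩, h38, h49, h5, h10⟩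
    exact ⟨⟨by linarith, h2, fun k => (h38 k).1, fun k => (h49 k).1, h5⟩,
      by linarith, h7, fun k => (h38 k).2, fun k => (h49 k).2, h10⟩

/-- The closed region to which the solutions are confined: a compact box in `{r₁ > 0, ε₁ > 0}`
together with the bound `c h` for `r₁² v_{k,1}`, which is `v_k` in the original variables. -/
def k1Trap (k₀ : ℕ) (c r₁ e₁ h : ℝ) : Set (K1State k₀) :=
  Icc (k1Lower k₀ c r₁ e₁) (k1Upper k₀ c) ∩ {x | ∀ k, |x.r ^ 2 * x.v k| ≤ c * h}

theorem continuous_coords (k₀ : ℕ) :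
    Continuous (K1State.u₁ (k₀ := k₀)) ∧ Continuous (K1State.r (k₀ := k₀)) ∧
      (∀ k, Continuous fun x : K1State k₀ => x.u k) ∧
      (∀ k, Continuous fun x : K1State k₀ => x.v k) ∧ Continuous (K1State.e (k₀ := k₀)) := by
  unfold K1State.e K1State.r K1State.u K1State.v K1State.u₁
  refine ⟨?_, ?_, ?_, ?_, ?_⟩ <;> fun_prop

theorem isClosed_k1Trap (k₀ : ℕ) (c r₁ e₁ h : ℝ) : IsClosed (k1Trap k₀ c r₁ e₁ h) := by
  obtain ⟨-, hr, -, hv, -⟩ := continuous_coords k₀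
  refine isCompact_Icc.isClosed.inter ?_
  rw [ofPred_forall]
  exact isClosed_iInter fun k => isClosed_le (((hr.pow 2).mul (hv k)).abs) continuous_const

theorem k1Trap_subset_k1Box {k₀ : ℕ} {c r₁ e₁ h : ℝ} (hr : 0 < r₁) (he : 0 < e₁) :
    k1Trap k₀ c r₁ e₁ h ⊆ k1Box k₀ c := by
  intro x hx
  obtain ⟨h1, ⟨h2, h3⟩, h4, h5, h6, h7⟩ := mem_Icc_k1Lower_k1Upper.1 hx.1
  exact ⟨h1, ⟨hr.trans_le h2, h3⟩, h4, h5, he.trans_le h6, h7⟩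

/-- Strict inequalities put a point in the interior of the trapping region. -/
theorem k1Trap_mem_nhds {k₀ : ℕ} {c r₁ e₁ h : ℝ} {x : K1State k₀}
    (h₁ : |x.u₁ + (2 : ℝ) ^ (1 / 4 : ℝ)| < c) (hr₁ : r₁ < x.r) (hr₂ : x.r < c)
    (hu : ∀ k, |x.u k| < c) (hv : ∀ k, |x.v k| < c) (he₁ : e₁ < x.e) (he₂ : x.e < c)
    (hW : ∀ k, |x.r ^ 2 * x.v k| < c * h) : k1Trap k₀ c r₁ e₁ h ∈ 𝓝 x := by
  obtain ⟨cw, cr, cu, cv, ce⟩ := continuous_coords k₀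
  have aux : ∀ {f g : K1State k₀ → ℝ}, Continuous f → Continuous g → f x < g x →
      ∀ᶠ y in 𝓝 x, f y ≤ g y := fun hf hg hlt =>
    (hf.continuousAt.eventually_lt hg.continuousAt hlt).mono fun _ => le_of_lt
  filter_upwards [aux (cw.add_const _).abs continuous_const h₁, aux continuous_const cr hr₁,
    aux cr continuous_const hr₂, eventually_all.2 fun k => aux (cu k).abs continuous_const (hu k),
    eventually_all.2 fun k => aux (cv k).abs continuous_const (hv k),
    aux continuous_const ce he₁, aux ce continuous_const he₂,
    eventually_all.2 fun k => aux ((cr.pow 2).mul (cv k)).abs continuous_const (hW k)]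
    with y y1 y2 y3 y4 y5 y6 y7 y8
  exact ⟨mem_Icc_k1Lower_k1Upper.2 ⟨y1, ⟨y2, y3⟩, y4, y5, y6, y7⟩, y8⟩

/-- The box of size `c` around `p_a` is small enough, and `K`, `E` are constants in the order
symbols and a bound for the quadratic coefficients there. -/
structure K1Local {k₀ : ℕ} (η : Mode k₀ → Mode k₀ → Mode k₀ → ℝ)
    (H₁ : K1State k₀ → ℝ) (Hu Hv : Mode k₀ → K1State k₀ → ℝ) (c K E : ℝ) : Prop where
  c_pos : 0 < c
  c_le : c ≤ 1 / 10
  card_mul_c : modeCard k₀ * c ≤ 1 / 8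
  E_mul_c : E * (modeCard k₀ * c) ^ 2 ≤ 1 / 8
  K_nonneg : 0 ≤ K
  K_mul_c : K * (modeCard k₀ * c) ^ 2 ≤ 1 / 2
  eta_le : ∀ k i j, |η k i j| ≤ E
  H₁_le : ∀ y ∈ k1Box k₀ c, |H₁ y| ≤ K * orderU₁ y
  Hu_le : ∀ k, ∀ y ∈ k1Box k₀ c, |Hu k y| ≤ K * orderU k y
  Hv_le : ∀ k, ∀ y ∈ k1Box k₀ c, |Hv k y| ≤ K * orderV k y
  regular : LocallyLipschitzOn (k1Box k₀ c) H₁ ∧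
    (∀ k, LocallyLipschitzOn (k1Box k₀ c) (Hu k)) ∧ ∀ k, LocallyLipschitzOn (k1Box k₀ c) (Hv k)

/-- `ρ` is small compared with the size `c` of the box and the damping rates `|b_k| / a²`. -/
structure K1SmallRadius {k₀ : ℕ} (a : ℝ) (b : Mode k₀ → ℝ) (c K ρ : ℝ) : Prop where
  pos : 0 < ρ
  lt : ρ < c
  remainder : K * (ρ * orderConst k₀) ≤ c / 8
  damping : ∀ k, K * ρ ^ 2 ≤ |b k| / (8 * a ^ 2)
  offset_u : ∀ k, 4 * a ^ 2 * ρ / |b k| ≤ c / 4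
  offset_v : ∀ k, (1 + 4 * a ^ 2 / |b k|) * ρ ^ 2 ≤ c / 4
  sq_le : ρ ^ 2 ≤ c / 4

theorem exists_k1Local {k₀ : ℕ} {η : Mode k₀ → Mode k₀ → Mode k₀ → ℝ}
    {H₁ : K1State k₀ → ℝ} {Hu Hv : Mode k₀ → K1State k₀ → ℝ}
    (hH₁ : H₁ =O[k1Near k₀] orderU₁)
    (hHu : ∀ k, Hu k =O[k1Near k₀] orderU k)
    (hHv : ∀ k, Hv k =O[k1Near k₀] orderV k)
    (hreg : ∃ S ∈ k1Near k₀, LocallyLipschitzOn S H₁ ∧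
      (∀ k, LocallyLipschitzOn S (Hu k)) ∧ ∀ k, LocallyLipschitzOn S (Hv k)) :
    ∃ c K E, K1Local η H₁ Hu Hv c K E := by
  have hev : ∀ᶠ K : ℝ in atTop, (∀ᶠ y in k1Near k₀, |H₁ y| ≤ K * orderU₁ y) ∧
      (∀ k, ∀ᶠ y in k1Near k₀, |Hu k y| ≤ K * orderU k y) ∧
      ∀ k, ∀ᶠ y in k1Near k₀, |Hv k y| ≤ K * orderV k y := by
    have hpos₁ : ∀ y : K1State k₀, 0 ≤ orderU₁ y := fun y => by unfold orderU₁; positivity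
    have hposu : ∀ k, ∀ y : K1State k₀, 0 ≤ orderU k y := fun k y => by unfold orderU; positivity
    have hposv : ∀ k, ∀ y : K1State k₀, 0 ≤ orderV k y := fun k y => by unfold orderV; positivity
    refine (Asymptotics.isBigO_iff_eventually.1 hH₁).and
      ((eventually_all.2 fun k => Asymptotics.isBigO_iff_eventually.1 (hHu k)).and
      (eventually_all.2 fun k => Asymptotics.isBigO_iff_eventually.1 (hHv k))) |>.mono ?_
    rintro K ⟨h1, h2, h3⟩
    simp only [Real.norm_eq_abs, abs_of_nonneg (hpos₁ _), abs_of_nonneg (hposu _ _),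
      abs_of_nonneg (hposv _ _)] at h1 h2 h3
    exact ⟨h1, h2, h3⟩
  obtain ⟨K, ⟨h1, h2, h3⟩, hK⟩ := (hev.and (eventually_ge_atTop 0)).exists
  obtain ⟨S, hS, hlip⟩ := hreg
  obtain ⟨c₁, hc₁, hsub⟩ := exists_k1Box_subset (inter_mem hS (h1.and
    ((eventually_all.2 h2).and (eventually_all.2 h3))))
  obtain ⟨E, hE⟩ : ∃ E : ℝ, ∀ k i j, |η k i j| ≤ E := by
    obtain ⟨E, hE⟩ := (finite_range fun p : Mode k₀ × Mode k₀ × Mode k₀ => |η p.1 p.2.1 p.2.2|).bddAbove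
    exact ⟨E, fun k i j => hE ⟨(k, i, j), rfl⟩⟩
  have hlim : ∀ D : ℝ, Tendsto (fun c : ℝ => D * (modeCard k₀ * c) ^ 2) (𝓝[>] 0) (𝓝 0) := fun D =>
    (Continuous.tendsto' (by fun_prop) 0 0 (by simp)).mono_left nhdsWithin_le_nhds
  have hlim' : Tendsto (fun c : ℝ => modeCard k₀ * c) (𝓝[>] 0) (𝓝 0) :=
    (Continuous.tendsto' (by fun_prop) 0 0 (by simp)).mono_left nhdsWithin_le_nhds
  have hsmall : ∀ᶠ c in 𝓝[>] (0 : ℝ), c ∈ Ioo 0 (min c₁ (1 / 10)) :=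
    Ioo_mem_nhdsGT (lt_min hc₁ (by norm_num))
  obtain ⟨c, ⟨hc, hcm⟩, hcE, hcK, hcN⟩ := (hsmall.and
    (((hlim E).eventually_le_const (by norm_num : (0 : ℝ) < 1 / 8)).and
    (((hlim K).eventually_le_const (by norm_num : (0 : ℝ) < 1 / 2)).and
    (hlim'.eventually_le_const (by norm_num : (0 : ℝ) < 1 / 8))))).exists
  have hbox : k1Box k₀ c ⊆ k1Box k₀ c₁ := k1Box_mono (hcm.le.trans (min_le_left _ _))
  have hS' : k1Box k₀ c ⊆ S := fun y hy => (hsub (hbox hy)).1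
  exact ⟨c, K, E,
    { c_pos := hc
      c_le := hcm.le.trans (min_le_right _ _)
      card_mul_c := hcN
      E_mul_c := hcE
      K_nonneg := hK
      K_mul_c := hcK
      eta_le := hE
      H₁_le := fun y hy => (hsub (hbox hy)).2.1
      Hu_le := fun k y hy => (hsub (hbox hy)).2.2.1 k
      Hv_le := fun k y hy => (hsub (hbox hy)).2.2.2 k
      regular := ⟨hlip.1.mono hS', fun k => (hlip.2.1 k).mono hS',
        fun k => (hlip.2.2 k).mono hS'⟩ }⟩

theorem exists_k1SmallRadius {k₀ : ℕ} {a : ℝ} (ha : 0 < a) {b : Mode k₀ → ℝ} (hb : ∀ k, b k < 0)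
    {c K : ℝ} (hc : 0 < c) :
    ∃ ρ₀ > 0, ∀ ρ, 0 < ρ → ρ ≤ ρ₀ → K1SmallRadius a b c K ρ := by
  have hlim : ∀ f : ℝ → ℝ, Continuous f → f 0 = 0 → ∀ B > 0, ∀ᶠ ρ in 𝓝[>] (0 : ℝ), f ρ < B :=
    fun f hf h0 B hB =>
      ((hf.tendsto' 0 0 h0).mono_left nhdsWithin_le_nhds).eventually_lt_const hB
  have hbk : ∀ k, 0 < |b k| := fun k => abs_pos.2 (hb k).ne
  have hev : ∀ᶠ ρ in 𝓝[>] (0 : ℝ), 0 < ρ → K1SmallRadius a b c K ρ := by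
    filter_upwards [hlim id continuous_id rfl c hc,
      hlim (fun ρ => K * (ρ * orderConst k₀)) (by fun_prop) (by simp) (c / 8) (by positivity),
      eventually_all.2 fun k => hlim (fun ρ => K * ρ ^ 2) (by fun_prop) (by simp)
        (|b k| / (8 * a ^ 2)) (by have := hbk k; positivity),
      eventually_all.2 fun k => hlim (fun ρ => 4 * a ^ 2 * ρ / |b k|) (by fun_prop) (by simp)
        (c / 4) (by positivity),
      eventually_all.2 fun k => hlim (fun ρ => (1 + 4 * a ^ 2 / |b k|) * ρ ^ 2) (by fun_prop)
        (by simp) (c / 4) (by positivity),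
      hlim (fun ρ => ρ ^ 2) (by fun_prop) (by simp) (c / 4) (by positivity)]
      with ρ h1 h2 h3 h4 h5 h6 hρ
    exact ⟨hρ, h1, h2.le, fun k => (h3 k).le, fun k => (h4 k).le, fun k => (h5 k).le, h6.le⟩
  obtain ⟨ρ₀, hρ₀, hsub⟩ := (mem_nhdsGT_iff_exists_Ioc_subset).1 hev
  exact ⟨ρ₀, hρ₀, fun ρ h0 h1 => hsub ⟨h0, h1⟩ h0⟩

/-! ### Confinement and existence -/

/-- The first integral `r₁³ ε₁`, raised to the power `2/3`. -/
theorem sq_mul_rpow_eq {r e ρ e₀ : ℝ} (hr : 0 < r) (he : 0 < e) (hρ : 0 < ρ) (he₀ : 0 < e₀)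
    (h : r ^ 3 * e = ρ ^ 3 * e₀) : r ^ 2 * e ^ (2 / 3 : ℝ) = ρ ^ 2 * e₀ ^ (2 / 3 : ℝ) := by
  have key : ∀ {r e : ℝ}, 0 < r → 0 < e → (r ^ 3 * e) ^ (2 / 3 : ℝ) = r ^ 2 * e ^ (2 / 3 : ℝ) := by
    intro r e hr he
    rw [Real.mul_rpow (by positivity) he.le, ← Real.rpow_natCast, ← Real.rpow_mul hr.le]
    norm_num
  rw [← key hr he, h, key hρ he₀]

section

variable {k₀ : ℕ} {a A : ℝ} {b : Mode k₀ → ℝ} {η : Mode k₀ → Mode k₀ → Mode k₀ → ℝ}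
  {H₁ : K1State k₀ → ℝ} {Hu Hv : Mode k₀ → K1State k₀ → ℝ} {c K E ρ δ e₀ w : ℝ}
  {u₀ v₀ : Mode k₀ → ℝ} {x : ℝ → K1State k₀}

/-- The a priori estimates for a solution that stays in the trapping region. -/
theorem IsK1Solution.estimates_of_mem_k1Trap (hloc : K1Local η H₁ Hu Hv c K E)
    (hrad : K1SmallRadius a b c K ρ)
    (ha : 0 < a) (hb : ∀ k, b k < 0) (he₀ : 0 < e₀) (hδ : 0 < δ) (hδc : δ ≤ c / 16)
    (hA : A = (ρ ^ 3 * e₀) ^ (1 / 6 : ℝ) * a) (hw : |w + (2 : ℝ) ^ (1 / 4 : ℝ)| ≤ c / 2) {s : ℝ}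
    (hx : IsK1Solution A b η H₁ Hu Hv s x) (hs : s ≤ k1Time δ e₀)
    (hx0 : x 0 = k1Initial ρ e₀ w u₀ v₀)
    (htrap : ∀ t ∈ Icc 0 s,
      x t ∈ k1Trap k₀ c (ρ * e₀ / (2 * δ)) (e₀ / 2) (ρ ^ 2 * e₀ ^ (2 / 3 : ℝ)))
    {t : ℝ} (ht : t ∈ Icc 0 s) :
    |(x t).u₁ + (2 : ℝ) ^ (1 / 4 : ℝ)| ≤ c / 2 ∧
      (∀ k, |(x t).u k| ≤ |u₀ k| / ρ + 4 * a ^ 2 * ρ / |b k|) ∧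
      ∀ k, |(x t).r ^ 2 * (x t).v k|
        ≤ |v₀ k| + 4 * a ^ 2 / |b k| * (ρ ^ 2 * e₀ ^ (2 / 3 : ℝ)) ^ 2 := by
  have hρ := hrad.pos
  have hc := hloc.c_pos
  have hr0 : (x 0).r = ρ := by rw [hx0]; rfl
  have he0 : (x 0).e = e₀ := by rw [hx0]; rfl
  have hu0 : ∀ k, (x 0).u k = u₀ k / ρ := fun k => by rw [hx0]; rfl
  have hv0 : ∀ k, (x 0).v k = v₀ k / ρ ^ 2 := fun k => by rw [hx0]; rfl
  have hr0' : 0 < (x 0).r := by rwa [hr0]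
  have he0' : 0 < (x 0).e := by rwa [he0]
  have hs' : s ≤ k1Time δ (x 0).e := by rwa [he0]
  have hbox : ∀ t ∈ Icc 0 s, x t ∈ k1Box k₀ c := fun t ht =>
    k1Trap_subset_k1Box (by positivity) (by positivity) (htrap t ht)
  have hr : ∀ t ∈ Icc 0 s, (x t).r ≤ ρ := fun t ht => hr0 ▸ hx.r_le he0' hr0' ht
  have he : ∀ t ∈ Icc 0 s, (x t).e ≤ δ := fun t ht => hx.e_le he0' hδ hs' ht
  have hε : ∀ t ∈ Icc 0 s, (x t).r ^ 3 * (x t).e = ρ ^ 3 * e₀ := fun t ht => by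
    rw [hx.r_pow_three_mul_e ht, hr0, he0]
  have hρc : K * (ρ * orderConst k₀) ≤ 1 / 8 := by linarith [hrad.remainder, hloc.c_le]
  refine ⟨hx.abs_u₁_add_le hc hloc.c_le hloc.card_mul_c hloc.K_nonneg hrad.remainder hδc hloc.H₁_le
      hbox hr he (by rwa [hx0]) t ht, fun k => ?_, fun k => ?_⟩
  · have := hx.abs_u_le ha hb hc hloc.c_le hloc.E_mul_c hloc.K_nonneg hloc.eta_le hρc hA hloc.Hu_le
      hbox hr hε k t ht
    rwa [hu0, abs_div, abs_of_pos hρ] at this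
  · have := hx.abs_r_sq_mul_v_le ha hb hloc.K_nonneg hloc.K_mul_c hrad.damping hA
      (fun k t ht => hloc.Hv_le k _ (hbox t ht)) (fun t ht => (hbox t ht).2.1.1)
      (fun t ht => (hbox t ht).2.2.2.2.1) hr hε (fun t ht => (htrap t ht).2) k t ht
    rwa [hr0, hv0, mul_div_cancel₀ _ (pow_ne_zero 2 hρ.ne')] at this

/-- A bound `C h²` for `v_k`, with `h = ε^{2/3}` and `C ρ² ≤ c / 4`, is better than the bounds
`c h` for `v_k` and `c` for `v_{k,1} = v_k / r₁²` that define the trapping region. -/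
theorem abs_v_lt_of_abs_r_sq_mul_v_le {r e v C : ℝ} (hc : 0 < c)
    (hρ : 0 < ρ) (he₀ : 0 < e₀) (he₀1 : e₀ ≤ 1) (hr : 0 < r) (he : 0 < e) (he1 : e ≤ 1)
    (hε : r ^ 3 * e = ρ ^ 3 * e₀) (hC : 0 ≤ C) (hCc : C * ρ ^ 2 ≤ c / 4)
    (hv : |r ^ 2 * v| ≤ C * (ρ ^ 2 * e₀ ^ (2 / 3 : ℝ)) ^ 2) :
    |r ^ 2 * v| < c * (ρ ^ 2 * e₀ ^ (2 / 3 : ℝ)) ∧ |v| < c := by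
  have h1 : e₀ ^ (2 / 3 : ℝ) ≤ 1 := Real.rpow_le_one he₀.le he₀1 (by norm_num)
  have h2 : e ^ (2 / 3 : ℝ) ≤ 1 := Real.rpow_le_one he.le he1 (by norm_num)
  have h0 : 0 < ρ ^ 2 * e₀ ^ (2 / 3 : ℝ) := by positivity
  have h3 : |r ^ 2 * v| ≤ c / 4 * (ρ ^ 2 * e₀ ^ (2 / 3 : ℝ)) := by
    refine hv.trans ?_
    rw [sq (ρ ^ 2 * _), ← mul_assoc]
    refine mul_le_mul_of_nonneg_right (le_trans ?_ hCc) h0.le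
    rw [← mul_assoc]
    exact mul_le_of_le_one_right (by positivity) h1
  refine ⟨h3.trans_lt (by nlinarith), ?_⟩
  rw [← sq_mul_rpow_eq hr he hρ he₀ hε, abs_mul, abs_of_pos (pow_pos hr 2)] at h3
  have h4 : r ^ 2 * |v| ≤ r ^ 2 * (c / 4) := h3.trans (by
    have := mul_le_of_le_one_right (pow_pos hr 2).le h2
    nlinarith)
  have h5 := le_of_mul_le_mul_left h4 (pow_pos hr 2)
  linarith

/-- A curve that solves the system as long as it stays in the trapping region never leaves the region.
This form of the hypothesis covers both the solutions of the system and those of the truncated one. -/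
theorem mem_k1Trap_of_solves (hloc : K1Local η H₁ Hu Hv c K E)
    (hrad : K1SmallRadius a b c K ρ)
    (ha : 0 < a) (hb : ∀ k, b k < 0) (he₀ : 0 < e₀) (he₀δ : e₀ ≤ δ) (hδc : δ ≤ c / 16)
    (hA : A = (ρ ^ 3 * e₀) ^ (1 / 6 : ℝ) * a) (hw : |w + (2 : ℝ) ^ (1 / 4 : ℝ)| ≤ c / 2)
    (hu₀ : ∀ k, |u₀ k| ≤ c * ρ / 4)
    (hv₀ : ∀ k, |v₀ k| ≤ (ρ ^ 2 * e₀ ^ (2 / 3 : ℝ)) ^ 2) {τ : ℝ}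
    (hτ : τ ≤ k1Time δ e₀) (hx0 : x 0 = k1Initial ρ e₀ w u₀ v₀) (hcont : ContinuousOn x (Icc 0 τ))
    (hx : ∀ s ∈ Icc 0 τ, (∀ t ∈ Icc 0 s,
      x t ∈ k1Trap k₀ c (ρ * e₀ / (2 * δ)) (e₀ / 2) (ρ ^ 2 * e₀ ^ (2 / 3 : ℝ))) →
        IsK1Solution A b η H₁ Hu Hv s x) :
    ∀ t ∈ Icc 0 τ,
      x t ∈ k1Trap k₀ c (ρ * e₀ / (2 * δ)) (e₀ / 2) (ρ ^ 2 * e₀ ^ (2 / 3 : ℝ)) := by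
  have hρ := hrad.pos
  have hc := hloc.c_pos
  have hc1 := hloc.c_le
  have hδ : 0 < δ := he₀.trans_le he₀δ
  -- `r₁³ ε₁ = ρ³ e₀` with `r₁ ≤ ρ` and `ε₁ ≤ δ` gives `r₁ ≥ ρ e₀ / δ`; the trap has half of this
  have hr₁ : ρ * e₀ / (2 * δ) < ρ * e₀ / δ := by
    have : 0 < ρ * e₀ / δ := by positivity
    rw [mul_comm 2 δ, ← div_div]; linarith
  have hr₁' : ρ * e₀ / δ ≤ ρ := by
    rw [div_le_iff₀ hδ]; gcongr
  have hu₀' : ∀ k, |u₀ k| / ρ ≤ c / 4 := fun k => by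
    rw [div_le_iff₀ hρ]; linarith [hu₀ k]
  refine mem_of_forall_mem_imp_mem_nhds (isClosed_k1Trap _ _ _ _ _) hcont ?_ ?_
  · have hv0 : ∀ k, |ρ ^ 2 * (v₀ k / ρ ^ 2)| < c * (ρ ^ 2 * e₀ ^ (2 / 3 : ℝ)) ∧
        |v₀ k / ρ ^ 2| < c := fun k => by
      refine abs_v_lt_of_abs_r_sq_mul_v_le hc hρ he₀ (by linarith) hρ he₀ (by linarith) rfl
        zero_le_one (by linarith [hrad.sq_le]) ?_
      rw [mul_div_cancel₀ _ (pow_ne_zero 2 hρ.ne'), one_mul]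
      exact hv₀ k
    rw [hx0]
    refine mem_of_mem_nhds (k1Trap_mem_nhds (x := k1Initial ρ e₀ w u₀ v₀) ?_ ?_ hrad.lt ?_
      (fun k => (hv0 k).2) ?_ ?_ (fun k => (hv0 k).1))
    · exact hw.trans_lt (by linarith)
    · exact hr₁.trans_le hr₁'
    · intro k
      change |u₀ k / ρ| < c
      rw [abs_div, abs_of_pos hρ]
      linarith [hu₀' k]
    · exact half_lt_self he₀
    · change e₀ < c; linarith
  · intro s hs htrap
    have hxs := hx s hs htrap
    have hss : s ∈ Icc 0 s := ⟨hs.1, le_rfl⟩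
    obtain ⟨h1, h2, h3⟩ := hxs.estimates_of_mem_k1Trap hloc hrad ha hb he₀ hδ hδc hA hw
      (hs.2.trans hτ) hx0 htrap hss
    have hr0 : (x 0).r = ρ := by rw [hx0]; rfl
    have he0 : (x 0).e = e₀ := by rw [hx0]; rfl
    have hr0' : 0 < (x 0).r := by rwa [hr0]
    have he0' : 0 < (x 0).e := by rwa [he0]
    have hs' : s ≤ k1Time δ (x 0).e := by rw [he0]; exact hs.2.trans hτ
    have her := hxs.e_ge hss
    have hed := hxs.e_le he0' hδ hs' hss
    have hrr := hxs.r_le he0' hr0' hss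
    have hrl := hxs.mul_div_le_r he0' hr0' hδ hs' hss
    have hε := hxs.r_pow_three_mul_e hss
    rw [hr0, he0] at hε hrl
    rw [he0] at her
    rw [hr0] at hrr
    have hv : ∀ k, |(x s).r ^ 2 * (x s).v k| < c * (ρ ^ 2 * e₀ ^ (2 / 3 : ℝ)) ∧
        |(x s).v k| < c := fun k => by
      refine abs_v_lt_of_abs_r_sq_mul_v_le (C := 1 + 4 * a ^ 2 / |b k|) hc hρ he₀ (by linarith)
        (hxs.r_pos he0' hr0' hss) (by linarith) (by linarith) hε (by positivity)
        (hrad.offset_v k) ?_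
      refine (h3 k).trans ?_
      linarith [hv₀ k]
    refine k1Trap_mem_nhds (h1.trans_lt (by linarith)) (hr₁.trans_le hrl) (hrr.trans_lt hrad.lt)
      (fun k => (h2 k).trans_lt (by linarith [hu₀' k, hrad.offset_u k])) (fun k => (hv k).2)
      (by linarith) (by linarith) (fun k => (hv k).1)

/-- Existence on the whole interval `[0, T₁]`: the solution of the system truncated to the compact box
never feels the truncation. -/
theorem exists_isK1Solution (hloc : K1Local η H₁ Hu Hv c K E)
    (hrad : K1SmallRadius a b c K ρ)
    (ha : 0 < a) (hb : ∀ k, b k < 0) (he₀ : 0 < e₀) (he₀δ : e₀ ≤ δ) (hδc : δ ≤ c / 16)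
    (hA : A = (ρ ^ 3 * e₀) ^ (1 / 6 : ℝ) * a) (hw : |w + (2 : ℝ) ^ (1 / 4 : ℝ)| ≤ c / 2)
    (hu₀ : ∀ k, |u₀ k| ≤ c * ρ / 4)
    (hv₀ : ∀ k, |v₀ k| ≤ (ρ ^ 2 * e₀ ^ (2 / 3 : ℝ)) ^ 2) :
    ∃ x : ℝ → K1State k₀, IsK1Solution A b η H₁ Hu Hv (k1Time δ e₀) x ∧
      x 0 = k1Initial ρ e₀ w u₀ v₀ := by
  have hρ := hrad.pos
  have hc := hloc.c_pos
  have hδ : 0 < δ := he₀.trans_le he₀δ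
  have hT : 0 ≤ k1Time δ e₀ := by
    have := one_div_le_one_div_of_le he₀ he₀δ
    exact mul_nonneg (by positivity) (by linarith)
  set lo := k1Lower k₀ c (ρ * e₀ / (2 * δ)) (e₀ / 2)
  set hi := k1Upper k₀ c
  have hsub : Icc lo hi ⊆ k1Box k₀ c := fun x hx => by
    obtain ⟨h1, ⟨h2, h3⟩, h4, h5, h6, h7⟩ := mem_Icc_k1Lower_k1Upper.1 hx
    exact ⟨h1, ⟨lt_of_lt_of_le (by positivity) h2, h3⟩, h4, h5,
      lt_of_lt_of_le (by positivity) h6, h7⟩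
  have hlohi : lo ≤ hi := by
    have hr : ρ * e₀ / (2 * δ) ≤ c := by
      rw [div_le_iff₀ (by positivity)]
      have := mul_le_mul hrad.lt.le he₀δ he₀.le hc.le
      nlinarith [mul_pos hc hδ]
    -- any point of the box shows that its corners are ordered
    have hmem : ((-(2 : ℝ) ^ (1 / 4 : ℝ), c, 0, 0, c) : K1State k₀) ∈ Icc lo hi := by
      refine mem_Icc_k1Lower_k1Upper.2 ⟨?_, ⟨hr, le_rfl⟩, fun k => ?_, fun k => ?_, ?_, le_rfl⟩
      · simp [K1State.u₁, hc.le]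
      · simp [K1State.u, hc.le]
      · simp [K1State.v, hc.le]
      · change e₀ / 2 ≤ c; linarith
    exact hmem.1.trans hmem.2
  obtain ⟨L, hL⟩ := exists_lipschitzOnWith_k1Field (A := A) (b := b) (η := η) isCompact_Icc
    (convex_Icc lo hi) (fun x hx => (hsub hx).2.2.2.2.1) (hloc.regular.1.mono hsub)
    (fun k => (hloc.regular.2.1 k).mono hsub) (fun k => (hloc.regular.2.2 k).mono hsub)
  obtain ⟨x, hx0, hx⟩ := exists_hasDerivWithinAt_comp_retraction isCompact_Icc hL
    (lipschitzWith_k1Clamp lo hi) (k1Clamp_mem hlohi) (k1Initial ρ e₀ w u₀ v₀) hT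
  -- inside the trapping region the truncated field is the field itself
  have hsol : ∀ s ∈ Icc 0 (k1Time δ e₀), (∀ t ∈ Icc 0 s,
      x t ∈ k1Trap k₀ c (ρ * e₀ / (2 * δ)) (e₀ / 2) (ρ ^ 2 * e₀ ^ (2 / 3 : ℝ))) →
        IsK1Solution A b η H₁ Hu Hv s x := fun s hs htrap t ht => by
    have := (hx t ⟨ht.1, ht.2.trans hs.2⟩).mono (Icc_subset_Icc_right hs.2)
    rwa [k1Clamp_of_mem (htrap t ht).1] at this
  exact ⟨x, hsol _ ⟨hT, le_rfl⟩ (mem_k1Trap_of_solves hloc hrad ha hb he₀ he₀δ hδc hA hw hu₀ hv₀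
    le_rfl hx0 (fun t ht => (hx t ht).continuousWithinAt) hsol), hx0⟩

end

/-! ### The transition estimate in the chart `K₁` -/

theorem le_of_sum_sq_le {ι : Type*} [Fintype ι] {C : ι → ℝ} {κ B : ℝ} (h : ∑ k, C k ^ 2 ≤ κ)
    (hB : 0 ≤ B) (hκ : κ ≤ B ^ 2) (k : ι) : C k ≤ B :=
  (le_abs_self _).trans (abs_le_of_sq_le_sq (((Finset.single_le_sum (f := fun k => C k ^ 2)
    (fun i _ => sq_nonneg (C i)) (Finset.mem_univ k)).trans h).trans hκ) hB)

theorem mainTheorem2 (k₀ : ℕ) (a : ℝ) (ha : 0 < a)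
    (b : Mode k₀ → ℝ) (hb : ∀ k, b k < 0)
    (η : Mode k₀ → Mode k₀ → Mode k₀ → ℝ)
    (H₁ : K1State k₀ → ℝ) (Hu Hv : Mode k₀ → K1State k₀ → ℝ)
    (hH₁ : H₁ =O[k1Near k₀] orderU₁)
    (hHu : ∀ k, Hu k =O[k1Near k₀] orderU k)
    (hHv : ∀ k, Hv k =O[k1Near k₀] orderV k)
    (hreg : ∃ S ∈ k1Near k₀, LocallyLipschitzOn S H₁ ∧
      (∀ k, LocallyLipschitzOn S (Hu k)) ∧ ∀ k, LocallyLipschitzOn S (Hv k)) :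
    ∃ c₀ > 0, ∃ ρ₀ > 0, ∃ δ₀ > 0, ∀ ρ : ℝ, 0 < ρ → ρ ≤ ρ₀ →
    ∃ κ₀ > 0, ∀ δ : ℝ, 0 < δ → δ ≤ δ₀ → ∀ κ : ℝ, 0 < κ → κ ≤ κ₀ →
    ∃ σu σv : ℝ, κ ≤ σu ∧ σu < 1 ∧ κ ≤ σv ∧ σv < 1 ∧
      ∀ e₀ ε A : ℝ, 0 < e₀ → e₀ ≤ δ → ε = ρ ^ 3 * e₀ → A = ε ^ (1 / 6 : ℝ) * a →
      ∀ (w : ℝ) (Cu Cv u₀ v₀ : Mode k₀ → ℝ),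
        |w + (2 : ℝ) ^ (1 / 4 : ℝ)| ≤ c₀ →
        (∀ k, |u₀ k| ≤ Cu k) → (∀ k, |v₀ k| ≤ Cv k * ε ^ (4 / 3 : ℝ)) →
        (∑ k, Cu k ^ 2) ≤ κ → (∑ k, Cv k ^ 2) ≤ κ →
        (∃ x : ℝ → K1State k₀, IsK1Solution A b η H₁ Hu Hv (k1Time δ e₀) x ∧
          x 0 = k1Initial ρ e₀ w u₀ v₀) ∧
        ∀ τ : ℝ, 0 ≤ τ → τ ≤ k1Time δ e₀ → ∀ x : ℝ → K1State k₀,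
          IsK1Solution A b η H₁ Hu Hv τ x → x 0 = k1Initial ρ e₀ w u₀ v₀ →
          ∀ t ∈ Set.Icc 0 τ, ∀ k : Mode k₀,
            |(x t).u k| ≤ 1 / ρ * |u₀ k| + 8 * a ^ 2 * ρ / |b k| *
              (σu + σv * e₀ ^ (2 / 3 : ℝ) * ρ ^ 2 * δ ^ (2 / 3 : ℝ) * (1 + 8 * a ^ 2 / |b k|)) ∧
            |(x t).v k| ≤ δ ^ (2 / 3 : ℝ) / (e₀ ^ (2 / 3 : ℝ) * ρ ^ 2) * |v₀ k|
              + e₀ ^ (2 / 3 : ℝ) * δ ^ (2 / 3 : ℝ) * (8 * a ^ 2 * ρ ^ 2 / |b k|) * σv ∧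
            δ ^ (2 / 3 : ℝ) / (e₀ ^ (2 / 3 : ℝ) * ρ ^ 2) * |v₀ k|
              + e₀ ^ (2 / 3 : ℝ) * δ ^ (2 / 3 : ℝ) * (8 * a ^ 2 * ρ ^ 2 / |b k|) * σv
              ≤ e₀ ^ (2 / 3 : ℝ) * ρ ^ 2 * δ ^ (2 / 3 : ℝ) * (Cv k + 8 * a ^ 2 / |b k| * σv) := by
  obtain ⟨c, K, E, hloc⟩ := exists_k1Local (η := η) hH₁ hHu hHv hreg
  have hc := hloc.c_pos
  have hc1 := hloc.c_le
  obtain ⟨ρ₀, hρ₀, hrad⟩ := exists_k1SmallRadius (K := K) ha hb hc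
  refine ⟨c / 2, by positivity, ρ₀, hρ₀, c / 16, by positivity, fun ρ hρ hρρ₀ => ?_⟩
  replace hrad := hrad ρ hρ hρρ₀
  -- `√κ ≤ c ρ / 4` keeps `u_{k,1}(0) = u_k(0) / ρ` inside the box of size `c`
  refine ⟨min (1 / 2) ((c * ρ / 4) ^ 2), by positivity, fun δ hδ hδc κ hκ hκ₀ => ?_⟩
  have hκ₁ : κ ≤ 1 / 2 := hκ₀.trans (min_le_left _ _)
  refine ⟨1 / 2, 1 / 2, hκ₁, by norm_num, hκ₁, by norm_num, ?_⟩
  rintro e₀ _ A he₀ he₀δ rfl hA w Cu Cv u₀ v₀ hw hu₀ hv₀ hCu hCv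
  have hε : (ρ ^ 3 * e₀) ^ (4 / 3 : ℝ) = (ρ ^ 2 * e₀ ^ (2 / 3 : ℝ)) ^ 2 := by
    rw [Real.mul_rpow (by positivity) he₀.le, mul_pow, ← Real.rpow_natCast, ← Real.rpow_mul hρ.le,
      ← Real.rpow_natCast (e₀ ^ (2 / 3 : ℝ)), ← Real.rpow_mul he₀.le, ← pow_mul]
    norm_num
  have hu₀' : ∀ k, |u₀ k| ≤ c * ρ / 4 := fun k =>
    (hu₀ k).trans (le_of_sum_sq_le hCu (by positivity) (hκ₀.trans (min_le_right _ _)) k)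
  rw [hε] at hv₀
  have hv₀' : ∀ k, |v₀ k| ≤ (ρ ^ 2 * e₀ ^ (2 / 3 : ℝ)) ^ 2 := fun k =>
    (hv₀ k).trans (mul_le_of_le_one_left (by positivity)
      (le_of_sum_sq_le hCv zero_le_one (by linarith) k))
  refine ⟨exists_isK1Solution hloc hrad ha hb he₀ he₀δ hδc hA hw hu₀' hv₀', ?_⟩
  intro τ hτ0 hτ x hx hx0 t ht k
  have htrap := mem_k1Trap_of_solves hloc hrad ha hb he₀ he₀δ hδc hA hw hu₀' hv₀' hτ hx0
    hx.continuousOn (fun s hs _ => hx.mono hs.2)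
  obtain ⟨-, hu, hv⟩ := hx.estimates_of_mem_k1Trap hloc hrad ha hb he₀ hδ hδc hA hw hτ hx0 htrap ht
  have hbk : 0 < |b k| := abs_pos.2 (hb k).ne
  have hr0 : (x 0).r = ρ := by rw [hx0]; rfl
  have he0 : (x 0).e = e₀ := by rw [hx0]; rfl
  have he0' : 0 < (x 0).e := by rwa [he0]
  have hrt := hx.r_pos he0' (by rwa [hr0]) ht
  have het : 0 < (x t).e := he0'.trans_le (hx.e_ge ht)
  have heδ := hx.e_le he0' hδ (by rwa [he0]) ht
  have hcons := hx.r_pow_three_mul_e ht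
  rw [hr0, he0] at hcons
  have hh := sq_mul_rpow_eq hrt het hρ he₀ hcons
  have hD : 0 < δ ^ (2 / 3 : ℝ) := by positivity
  have hF : 0 < e₀ ^ (2 / 3 : ℝ) := by positivity
  refine ⟨?_, ?_, ?_⟩
  · calc |(x t).u k| ≤ |u₀ k| / ρ + 4 * a ^ 2 * ρ / |b k| := hu k
      _ = 1 / ρ * |u₀ k| + 8 * a ^ 2 * ρ / |b k| * (1 / 2 + 0) := by ring
      _ ≤ _ := by
        gcongr
        positivity
  · -- `1 / r₁² = ε₁^{2/3} / ε^{2/3}` and `ε₁ ≤ δ`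
    have h1 : (ρ ^ 2 * e₀ ^ (2 / 3 : ℝ)) * |(x t).v k| ≤ δ ^ (2 / 3 : ℝ) *
        (|v₀ k| + 4 * a ^ 2 / |b k| * (ρ ^ 2 * e₀ ^ (2 / 3 : ℝ)) ^ 2) := by
      calc (ρ ^ 2 * e₀ ^ (2 / 3 : ℝ)) * |(x t).v k|
          = (x t).e ^ (2 / 3 : ℝ) * |(x t).r ^ 2 * (x t).v k| := by
            rw [← hh, abs_mul, abs_of_pos (pow_pos hrt 2)]; ring
        _ ≤ _ := by
            have := hv k
            gcongr
    refine le_of_mul_le_mul_left (h1.trans (le_of_eq ?_)) (by positivity :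
      0 < ρ ^ 2 * e₀ ^ (2 / 3 : ℝ))
    field_simp
    ring
  · have h1 := mul_le_mul_of_nonneg_left (hv₀ k)
      (by positivity : 0 ≤ δ ^ (2 / 3 : ℝ) / (e₀ ^ (2 / 3 : ℝ) * ρ ^ 2))
    refine (add_le_add_left h1 _).trans (le_of_eq ?_)
    field_simp
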